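/- Fix a real number $a>0$. The Buckley--Osthus random graph $H_{a,1}^N$ is built inductively, starting from the empty graph $H_{a,1}^0$: for $t=1,\dots,N$ one adds to $H_{a,1}^{t-1}$ the vertex $t$ and one edge joining $t$ to a random vertex $i$ with $$\mathsf P(i=s)=\frac{d_{H_{a,1}^{t-1}}(s)-1+a}{(a+1)t-1}\quad(1\le s\le t-1),\qquad \mathsf P(i=t)=\frac{a}{(a+1)t-1},$$ where $d$ denotes the degree (a loop contributes $2$). For $m\ge 1$ the random multigraph $H_{a,m}^n$ is obtained from $H_{a,1}^{mn}$ by identifying the vertices $(j-1)m+1,\dots,jm$ to the $j$-th vertex, $1\le j\le n$, and keeping all $mn$ edges (so multiple edges and loops may occur). The second degree of a vertex $t$ is the number of edges, counted with multiplicity, that are incident to a neighbour $i\neq t$ of $t$ and are not incident to $t$. For a positive integer $k$, let $Y_n^m(k)$ be the number of vertices of $H_{a,m}^n$ whose second degree is at least $k$. Suppose that the following conjecture is true: for every integer $m>1$ and every sequence of positive integers $k=k(n)$ with $k=O\bigl(n^{\min\{\frac1{2+a},\frac1{2a}\}}\bigr)$, one has $\mathsf E\,Y_n^m(k)=\Theta\bigl(n/k^a\bigr)$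 as $n\to\infty$. Theorem. Let $m\ge 1$ be an integer, let $\delta>0$, and let $k=k(n)$ be a sequence of positive integers with $k=O\bigl(n^{\min\{\frac1{2+a+\delta},\frac1{2a+\delta}\}}\bigr)$. Then for some $\epsilon>0$ $$\mathsf P\Bigl(\bigl|Y_n^m(k)-\mathsf E\,Y_n^m(k)\bigr|>\bigl(\mathsf E\,Y_n^m(k)\bigr)^{1-\epsilon}\Bigr)=o(1)\qquad(n\to\infty).$$ -/

import Mathlib

open Filter Topology MeasureTheory Asymptotics

/-- A finite multigraph (multiple edges and loops allowed): every edge `e` joins the vertices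
`src e` and `tgt e`; the order of the two endpoints plays no role in the notions below. -/
structure Multigraph (V E : Type*) where
  src : E → V
  tgt : E → V

namespace Multigraph

variable {V E : Type*} (G : Multigraph V E)

/-- The edge `e` is incident to the vertex `v`. -/
def Incident (e : E) (v : V) : Prop := G.src e = v ∨ G.tgt e = v

/-- The edge `e` is an edge `uv`. -/
def Joins (e : E) (u v : V) : Prop :=
  (G.src e = u ∧ G.tgt e = v) ∨ (G.src e = v ∧ G.tgt e = u)

/-- `u` is a neighbour of `v`: it is different from `v` and there is an edge `uv`. -/
def Neighbor (u v : V) : Prop := u ≠ v ∧ ∃ e, G.Joins e u v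

open Classical in
/-- The degree of `v`; a loop contributes `2`. -/
noncomputable def degree [Fintype E] (v : V) : ℕ :=
  (Finset.univ.filter fun e => G.src e = v).card + (Finset.univ.filter fun e => G.tgt e = v).card

open Classical in
/-- The second degree of `t`: the number of edges (with multiplicity) that are incident to a
neighbour of `t`, except for the edges incident to `t`. -/
noncomputable def secondDegree [Fintype E] (t : V) : ℕ :=
  (Finset.univ.filter fun e => ¬ G.Incident e t ∧ ∃ i, G.Neighbor i t ∧ G.Incident e i).card

open Classical in
/-- The number of `k`-vertices, i.e. of vertices whose second degree is at least `k`. -/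
noncomputable def numKVertices [Fintype V] [Fintype E] (k : ℕ) : ℕ :=
  (Finset.univ.filter fun t => k ≤ G.secondDegree t).card

end Multigraph

namespace BuckleyOsthus

/-- The graph with vertex set `Fin N` (the vertex `i` is the `(i+1)`-st one) in which every vertex
`i` has sent one edge, to the vertex `f i`. -/
def graphOne {N : ℕ} (f : Fin N → Fin N) : Multigraph (Fin N) (Fin N) where
  src := id
  tgt := f

/-- The graph obtained by identifying the vertices of `graphOne f` in consecutive groups of `m`:
the vertex `i` goes to `i / m`; edges are kept, one to one. -/
def graphMerged {n m : ℕ} (f : Fin (n * m) → Fin (n * m)) : Multigraph (Fin n) (Fin (n * m)) where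
  src := fun e => e.divNat
  tgt := fun e => (f e).divNat

/-- The probability that the new vertex `t = N + 1` of the graph on `N + 1` vertices sends its edge
to the vertex `s`: `(d(s) - 1 + a) / ((a + 1) t - 1)` for an old vertex `s`, and
`a / ((a + 1) t - 1)` for `s = t`. -/
noncomputable def attachProb (a : ℝ) {N : ℕ} (f : Fin N → Fin N) (s : Fin (N + 1)) : ℝ :=
  Fin.lastCases (motive := fun _ => ℝ) a
    (fun s : Fin N => ((graphOne f).degree s : ℝ) - 1 + a) s / ((a + 1) * ((N : ℝ) + 1) - 1)

theorem one_le_degree {N : ℕ} (f : Fin N → Fin N) (s : Fin N) : 1 ≤ (graphOne f).degree s := by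
  have h : s ∈ Finset.univ.filter fun e => (graphOne f).src e = s :=
    Finset.mem_filter.mpr ⟨Finset.mem_univ _, rfl⟩
  have h' := Finset.card_pos.mpr ⟨s, h⟩
  unfold Multigraph.degree
  convert Nat.le_add_right_of_le h'

theorem sum_degree {N : ℕ} (f : Fin N → Fin N) : ∑ s, (graphOne f).degree s = 2 * N := by
  classical
  have h (g : Fin N → Fin N) : ∑ s, (Finset.univ.filter fun e => g e = s).card = N := by
    have := Finset.card_eq_sum_card_fiberwise (f := g) (s := Finset.univ) (t := Finset.univ)
      (fun _ _ => by simp)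
    simpa using this.symm
  unfold Multigraph.degree
  rw [Finset.sum_add_distrib, two_mul]
  congr 1
  · convert h (graphOne f).src
  · convert h (graphOne f).tgt

theorem denom_pos {a : ℝ} (ha : 0 < a) (N : ℕ) : 0 < (a + 1) * ((N : ℝ) + 1) - 1 := by
  have : (0 : ℝ) ≤ N := N.cast_nonneg
  nlinarith

theorem attachProb_nonneg {a : ℝ} (ha : 0 < a) {N : ℕ} (f : Fin N → Fin N) (s : Fin (N + 1)) :
    0 ≤ attachProb a f s := by
  unfold attachProb
  refine div_nonneg ?_ (denom_pos ha N).le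
  refine Fin.lastCases ?_ (fun s => ?_) s
  · simpa using ha.le
  · have : (1 : ℝ) ≤ (graphOne f).degree s := by exact_mod_cast one_le_degree f s
    simp only [Fin.lastCases_castSucc]
    linarith

theorem sum_attachProb {a : ℝ} (ha : 0 < a) {N : ℕ} (f : Fin N → Fin N) :
    ∑ s, attachProb a f s = 1 := by
  have h : ∑ s, ((graphOne f).degree s : ℝ) = 2 * N := by exact_mod_cast sum_degree f
  unfold attachProb
  rw [← Finset.sum_div, div_eq_one_iff_eq (denom_pos ha N).ne', Fin.sum_univ_castSucc]
  simp only [Fin.lastCases_castSucc, Fin.lastCases_last, Finset.sum_add_distrib,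
    Finset.sum_sub_distrib, h]
  simp
  ring

/-- The law of the endpoint of the edge sent by the new vertex. -/
noncomputable def attach {a : ℝ} (ha : 0 < a) {N : ℕ} (f : Fin N → Fin N) : PMF (Fin (N + 1)) :=
  PMF.ofFintype (fun s => ENNReal.ofReal (attachProb a f s)) (by
    rw [← ENNReal.ofReal_sum_of_nonneg (fun s _ => attachProb_nonneg ha f s), sum_attachProb ha f,
      ENNReal.ofReal_one])

/-- The random graph with `m = 1` on `N` vertices, as the law of the map that sends each vertex to
the endpoint of the edge it has sent; it starts with the empty graph and adds one vertex and one
edge at each step. -/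
noncomputable def law {a : ℝ} (ha : 0 < a) : (N : ℕ) → PMF (Fin N → Fin N)
  | 0 => PMF.pure id
  | N + 1 => (law ha N).bind fun f => (attach ha f).map fun s =>
      Fin.snoc (α := fun _ => Fin (N + 1)) (fun i => (f i).castSucc) s

/-- The probability measure of the random graph with `n` vertices and `m` edges per vertex; its
points `f` stand for the graphs `graphMerged f`. -/
noncomputable def prob {a : ℝ} (ha : 0 < a) (m n : ℕ) :
    Measure (Fin (n * m) → Fin (n * m)) :=
  (law ha (n * m)).toMeasure

/-- The random variable `Y`: the number of `k`-vertices. -/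
noncomputable def Y (m n k : ℕ) (f : Fin (n * m) → Fin (n * m)) : ℝ :=
  ((graphMerged f : Multigraph (Fin n) (Fin (n * m))).numKVertices k : ℝ)

/-- The expectation of `Y`. -/
noncomputable def EY {a : ℝ} (ha : 0 < a) (m n k : ℕ) : ℝ :=
  ∫ f, Y m n k f ∂(prob ha m n)

/-- The conjecture on the expected number of `k`-vertices: for every `m > 1` and
`k = O(n ^ min {1 / (2 + a), 1 / (2 a)})` it is `Θ(n / k ^ a)`. -/
def ExpectationConjecture {a : ℝ} (ha : 0 < a) : Prop :=
  ∀ m : ℕ, 1 < m → ∀ k : ℕ → ℕ, (∀ n, 1 ≤ k n) →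
    ((fun n => (k n : ℝ)) =O[atTop]
      fun n : ℕ => (n : ℝ) ^ min (1 / (2 + a)) (1 / (2 * a))) →
    (fun n => EY ha m n (k n)) =Θ[atTop] fun n : ℕ => (n : ℝ) / (k n : ℝ) ^ a

end BuckleyOsthus

/-! The theorem follows from Chebyshev's inequality, an Efron–Stein bound on the variance of `Y`,
and a lower bound on its mean.

Preferential attachment is realised by independent choices. Vertex `t` (counted from 0) either
copies the endpoint of one of the `t` earlier edges, each with weight 1, or picks one of the `t + 1`
available vertices, each with weight `a`; the total `t + a (t + 1)` is the denominator of the model.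
`sum_law_mul` shows that this gives the right law.

Resampling the choice of `t` moves the endpoints of all edges derived from `t` by copying, the set
`D` of its descendants, together from one vertex `u` to another vertex `v`. By the one-sided
inequality `variance_le_sum_expect` only the `k`-vertices lost by such a move have to be counted.
Fix for each `k`-vertex a certificate of `k` edges counted by its second degree. By `card_lost_le`
the loss is at most `|D| + 2 + min (S, k + 2m)`, where `S` is the number of certificates that meet
`D`. Its square is at most a constant times `|D|² + (k + 2m) S`.

Two sums over `t` remain. The second moments of `|D|` add up to at most `2 N^q (1 + log N)` with `N
= nm` and `q = max 1 (2 / (1 + a))`. The sum of `S` is at most the total number of ancestors of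
certificate edges; copying chains have exponential moments of polynomial size, so up to a negligible
term this is `k n^η Y`. For `k = O(n^β)` the variance is therefore `O(n^(q + η) + n^(2β + η) E Y)`.

The bound `E Y ≥ c n / k^a` is proved directly, for every `m ≥ 1`: among the oldest vertices, about
`n / k^(1 + a)` have expected indegree of order at least `k`, and sending an edge to a vertex of
large indegree makes the sender a `k`-vertex. Hence `E Y` is at least of order `n^(1 - aβ)`, and
Chebyshev succeeds if `q < 2 (1 - aβ)` and `2β < 1 - aβ`. The margin `δ` makes these inequalities
strict. -/

namespace BuckleyOsthus

/-- The weight of the `c`-th choice (`c ≤ 2 t`) of the vertex `t`: the choices `c < t` copy the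
endpoint of the edge `c`, the choice `t + s` selects the vertex `s`. -/
noncomputable def weight (a : ℝ) (t c : ℕ) : ℝ :=
  (if c < t then 1 else a) / ((a + 1) * ((t : ℝ) + 1) - 1)

/-- The expectation of a function of independent choices `ω 0, …, ω (N - 1)`. -/
noncomputable def expect (a : ℝ) : ℕ → ((ℕ → ℕ) → ℝ) → ℝ
  | 0, g => g 0
  | N + 1, g => expect a N fun ω =>
      ∑ c ∈ Finset.range (2 * N + 1), weight a N c * g (Function.update ω N c)

/-- The endpoint of the edge sent by `t`, as a function of the choices. -/
def target (ω : ℕ → ℕ) (t : ℕ) : ℕ :=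
  if _h : ω t < t then target ω (ω t) else min (ω t - t) t
termination_by t

/-- The edges from which the endpoint of the edge `t` has been copied, including `t` itself. -/
def ancestors (ω : ℕ → ℕ) (t : ℕ) : Finset ℕ :=
  if _h : ω t < t then insert t (ancestors ω (ω t)) else {t}
termination_by t

/-! ### Expectation over independent choices. -/

section Expect

variable {a : ℝ}

theorem weight_nonneg (ha : 0 < a) (t c : ℕ) : 0 ≤ weight a t c := by
  unfold weight
  refine div_nonneg ?_ (denom_pos ha t).le
  split_ifs <;> linarith

theorem sum_weight_mul (t : ℕ) (g : ℕ → ℝ) :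
    ∑ c ∈ Finset.range (2 * t + 1), weight a t c * g c =
      (∑ c ∈ Finset.range t, g c + a * ∑ s ∈ Finset.range (t + 1), g (t + s)) /
        ((a + 1) * ((t : ℝ) + 1) - 1) := by
  rw [show 2 * t + 1 = t + (t + 1) by ring, Finset.sum_range_add, add_div, Finset.sum_div,
    Finset.mul_sum, Finset.sum_div]
  congr 1
  · refine Finset.sum_congr rfl fun c hc => ?_
    rw [weight, if_pos (Finset.mem_range.mp hc)]
    ring
  · refine Finset.sum_congr rfl fun c _ => ?_
    rw [weight, if_neg (by omega)]
    ring

theorem sum_weight (ha : 0 < a) (t : ℕ) :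
    ∑ c ∈ Finset.range (2 * t + 1), weight a t c = 1 := by
  have := sum_weight_mul (a := a) t fun _ => 1
  simp only [mul_one] at this
  rw [this, div_eq_one_iff_eq (denom_pos ha t).ne']
  simp
  ring

theorem expect_succ (N : ℕ) (g : (ℕ → ℕ) → ℝ) :
    expect a (N + 1) g = expect a N fun ω =>
      ∑ c ∈ Finset.range (2 * N + 1), weight a N c * g (Function.update ω N c) := rfl

theorem expect_mono (ha : 0 < a) (N : ℕ) {g h : (ℕ → ℕ) → ℝ} (hgh : ∀ ω, g ω ≤ h ω) :
    expect a N g ≤ expect a N h := by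
  induction N generalizing g h with
  | zero => exact hgh _
  | succ N ih =>
    exact ih fun ω => Finset.sum_le_sum fun c _ =>
      mul_le_mul_of_nonneg_left (hgh _) (weight_nonneg ha N c)

theorem expect_add (N : ℕ) (g h : (ℕ → ℕ) → ℝ) :
    expect a N (fun ω => g ω + h ω) = expect a N g + expect a N h := by
  induction N generalizing g h with
  | zero => rfl
  | succ N ih => simp only [expect_succ, mul_add, Finset.sum_add_distrib, ih]

theorem expect_const_mul (N : ℕ) (r : ℝ) (g : (ℕ → ℕ) → ℝ) :
    expect a N (fun ω => r * g ω) = r * expect a N g := by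
  induction N generalizing g with
  | zero => rfl
  | succ N ih =>
    simp only [expect_succ, mul_left_comm _ r, ← Finset.mul_sum, ih]

theorem expect_const (ha : 0 < a) (N : ℕ) (r : ℝ) : expect a N (fun _ => r) = r := by
  induction N with
  | zero => rfl
  | succ N ih => simp only [expect_succ, ← Finset.sum_mul, sum_weight ha, one_mul, ih]

theorem expect_sub (N : ℕ) (g h : (ℕ → ℕ) → ℝ) :
    expect a N (fun ω => g ω - h ω) = expect a N g - expect a N h := by
  have h1 := expect_add (a := a) N g fun ω => (-1) * h ω
  rw [expect_const_mul] at h1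
  simp only [sub_eq_add_neg]
  simpa using h1

theorem expect_sum (N : ℕ) {ι : Type*} (s : Finset ι) (g : ι → (ℕ → ℕ) → ℝ) :
    expect a N (fun ω => ∑ i ∈ s, g i ω) = ∑ i ∈ s, expect a N (g i) := by
  classical
  induction s using Finset.induction_on with
  | empty => simpa using expect_const_mul (a := a) N 0 fun _ => 0
  | insert i s his ih => simp only [Finset.sum_insert his, expect_add, ih]

end Expect

/-! ### Variance: one-sided Efron–Stein and Chebyshev. -/

section EfronStein

theorem sq_sum_mul_le {ι : Type*} (s : Finset ι) (w z : ι → ℝ) (hw : ∀ i ∈ s, 0 ≤ w i)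
    (h1 : ∑ i ∈ s, w i = 1) : (∑ i ∈ s, w i * z i) ^ 2 ≤ ∑ i ∈ s, w i * z i ^ 2 := by
  set μ := ∑ i ∈ s, w i * z i with hμ
  have h : 0 ≤ ∑ i ∈ s, w i * (z i - μ) ^ 2 :=
    Finset.sum_nonneg fun i hi => mul_nonneg (hw i hi) (sq_nonneg _)
  have e : ∑ i ∈ s, w i * (z i - μ) ^ 2 = ∑ i ∈ s, w i * z i ^ 2 - 2 * μ * μ + μ ^ 2 := by
    have : ∀ i, w i * (z i - μ) ^ 2 = w i * z i ^ 2 - 2 * μ * (w i * z i) + μ ^ 2 * w i :=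
      fun i => by ring
    simp only [this, Finset.sum_add_distrib, Finset.sum_sub_distrib, ← Finset.mul_sum, h1, ← hμ,
      mul_one]
  nlinarith

theorem sq_posPart_sum_mul_le {ι : Type*} (s : Finset ι) (w z : ι → ℝ) (hw : ∀ i ∈ s, 0 ≤ w i)
    (h1 : ∑ i ∈ s, w i = 1) :
    (max (∑ i ∈ s, w i * z i) 0) ^ 2 ≤ ∑ i ∈ s, w i * (max (z i) 0) ^ 2 := by
  refine le_trans ?_ (sq_sum_mul_le s w (fun i => max (z i) 0) hw h1)
  refine pow_le_pow_left₀ (le_max_right _ _) (max_le ?_ ?_) 2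
  · exact Finset.sum_le_sum fun i hi => mul_le_mul_of_nonneg_left (le_max_left _ _) (hw i hi)
  · exact Finset.sum_nonneg fun i hi => mul_nonneg (hw i hi) (le_max_right _ _)

/-- The variance is half the double sum of `w i * w j * (z i - z j) ^ 2`. Exchanging `i` and `j`
shows that the positive and the negative parts of the differences contribute equally. -/
theorem variance_eq_sum_posPart {ι : Type*} (s : Finset ι) (w z : ι → ℝ)
    (h1 : ∑ i ∈ s, w i = 1) :
    ∑ i ∈ s, w i * z i ^ 2 - (∑ i ∈ s, w i * z i) ^ 2 =
      ∑ i ∈ s, w i * ∑ j ∈ s, w j * (max (z i - z j) 0) ^ 2 := by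
  set A := ∑ i ∈ s, w i * ∑ j ∈ s, w j * (max (z i - z j) 0) ^ 2 with hA
  have hA' : A = ∑ i ∈ s, w i * ∑ j ∈ s, w j * (max (z j - z i) 0) ^ 2 := by
    simp only [hA, Finset.mul_sum]
    rw [Finset.sum_comm]
    exact Finset.sum_congr rfl fun i _ => Finset.sum_congr rfl fun j _ => by ring
  have key : ∀ x : ℝ, (max x 0) ^ 2 + (max (-x) 0) ^ 2 = x ^ 2 := fun x => by
    rcases le_total 0 x with h | h
    · rw [max_eq_left h, max_eq_right (by linarith)]; ring
    · rw [max_eq_right h, max_eq_left (by linarith)]; ring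
  have h2 : A + A = ∑ i ∈ s, ∑ j ∈ s, w i * w j * (z i - z j) ^ 2 := by
    nth_rewrite 2 [hA']
    simp only [hA, Finset.mul_sum, ← Finset.sum_add_distrib]
    refine Finset.sum_congr rfl fun i _ => Finset.sum_congr rfl fun j _ => ?_
    rw [← key (z i - z j), neg_sub]
    ring
  have h3 : ∑ i ∈ s, ∑ j ∈ s, w i * w j * (z i - z j) ^ 2 =
      (∑ i ∈ s, w i * z i ^ 2) * (∑ j ∈ s, w j) + (∑ i ∈ s, w i) * (∑ j ∈ s, w j * z j ^ 2)
        - 2 * ((∑ i ∈ s, w i * z i) * (∑ j ∈ s, w j * z j)) := by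
    rw [Finset.sum_mul_sum, Finset.sum_mul_sum, Finset.sum_mul_sum]
    simp only [Finset.mul_sum, ← Finset.sum_add_distrib, ← Finset.sum_sub_distrib]
    exact Finset.sum_congr rfl fun i _ => Finset.sum_congr rfl fun j _ => by ring
  rw [h1] at h3
  nlinarith

/-- The one-sided Efron–Stein inequality. -/
theorem variance_le_sum_expect {a : ℝ} (ha : 0 < a) (N : ℕ) (g : (ℕ → ℕ) → ℝ) :
    expect a N (fun ω => g ω ^ 2) - expect a N g ^ 2 ≤
      ∑ t ∈ Finset.range N, expect a N fun ω => ∑ c ∈ Finset.range (2 * t + 1),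
        weight a t c * (max (g ω - g (Function.update ω t c)) 0) ^ 2 := by
  induction N generalizing g with
  | zero => simp [expect]
  | succ N ih =>
    -- `G` averages out the last choice. The variance of `g` is the mean conditional variance given
    -- the earlier choices, plus the variance of `G`, to which the induction hypothesis applies.
    set G : (ℕ → ℕ) → ℝ := fun ω =>
      ∑ c ∈ Finset.range (2 * N + 1), weight a N c * g (Function.update ω N c) with hG
    have hw : ∀ c ∈ Finset.range (2 * N + 1), 0 ≤ weight a N c := fun c _ => weight_nonneg ha N c
    have h1 : expect a (N + 1) (fun ω => g ω ^ 2) - expect a N (fun ω => G ω ^ 2) =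
        expect a (N + 1) fun ω => ∑ c ∈ Finset.range (2 * N + 1),
          weight a N c * (max (g ω - g (Function.update ω N c)) 0) ^ 2 := by
      rw [expect_succ, expect_succ, ← expect_sub]
      congr 1
      funext ω
      simp only [Function.update_idem]
      exact variance_eq_sum_posPart _ _ _ (sum_weight ha N)
    have h2 : ∀ t ∈ Finset.range N,
        (expect a N fun ω => ∑ c ∈ Finset.range (2 * t + 1),
          weight a t c * (max (G ω - G (Function.update ω t c)) 0) ^ 2) ≤
        expect a (N + 1) fun ω => ∑ c ∈ Finset.range (2 * t + 1),
          weight a t c * (max (g ω - g (Function.update ω t c)) 0) ^ 2 := by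
      intro t ht
      have htN : t ≠ N := (Finset.mem_range.mp ht).ne
      rw [expect_succ]
      refine expect_mono ha N fun ω => ?_
      simp only [Finset.mul_sum]
      rw [Finset.sum_comm]
      refine Finset.sum_le_sum fun c _ => ?_
      simp only [mul_left_comm _ (weight a t c), ← Finset.mul_sum]
      refine mul_le_mul_of_nonneg_left ?_ (weight_nonneg ha t c)
      -- Jensen for the convex function `x ↦ (max x 0) ^ 2`: averaging over the last choice only
      -- decreases the resampling terms.
      refine le_trans (le_of_eq ?_) (sq_posPart_sum_mul_le _ _ _ hw (sum_weight ha N))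
      congr 2
      simp only [hG, mul_sub, Finset.sum_sub_distrib, Function.update_comm htN]
    rw [Finset.sum_range_succ, ← h1]
    have h3 := (ih G).trans (Finset.sum_le_sum h2)
    have h4 : expect a (N + 1) g = expect a N G := rfl
    rw [h4]
    linarith

theorem expect_sq_sub {a : ℝ} (ha : 0 < a) (N : ℕ) (g : (ℕ → ℕ) → ℝ) :
    expect a N (fun ω => (g ω - expect a N g) ^ 2) =
      expect a N (fun ω => g ω ^ 2) - expect a N g ^ 2 := by
  set μ := expect a N g with hμ
  have : (fun ω => (g ω - μ) ^ 2) = fun ω => (g ω ^ 2 - (2 * μ) * g ω) + μ ^ 2 := by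
    funext ω; ring
  rw [this, expect_add, expect_sub, expect_const_mul, expect_const ha, ← hμ]
  ring

open Classical in
theorem chebyshev {a : ℝ} (ha : 0 < a) (N : ℕ) (g : (ℕ → ℕ) → ℝ) {r : ℝ} (hr : 0 < r) :
    expect a N (fun ω => if r < |g ω - expect a N g| then 1 else 0) ≤
      (expect a N (fun ω => g ω ^ 2) - expect a N g ^ 2) / r ^ 2 := by
  rw [← expect_sq_sub ha, le_div_iff₀ (by positivity), mul_comm, ← expect_const_mul]
  refine expect_mono ha N fun ω => ?_
  split_ifs with h
  · rw [mul_one, ← sq_abs (g ω - _)]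
    exact pow_le_pow_left₀ hr.le h.le 2
  · simpa using sq_nonneg _

end EfronStein

/-! ### Copying chains and the effect of changing one choice. -/

section Target

theorem target_of_lt {ω : ℕ → ℕ} {t : ℕ} (h : ω t < t) : target ω t = target ω (ω t) := by
  rw [target, dif_pos h]

theorem target_of_le {ω : ℕ → ℕ} {t : ℕ} (h : t ≤ ω t) : target ω t = min (ω t - t) t := by
  rw [target, dif_neg h.not_gt]

theorem ancestors_of_lt {ω : ℕ → ℕ} {t : ℕ} (h : ω t < t) :
    ancestors ω t = insert t (ancestors ω (ω t)) := by
  rw [ancestors, dif_pos h]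

theorem ancestors_of_le {ω : ℕ → ℕ} {t : ℕ} (h : t ≤ ω t) : ancestors ω t = {t} := by
  rw [ancestors, dif_neg h.not_gt]

theorem self_mem_ancestors (ω : ℕ → ℕ) (t : ℕ) : t ∈ ancestors ω t := by
  rcases lt_or_ge (ω t) t with h | h
  · simp [ancestors_of_lt h]
  · simp [ancestors_of_le h]

theorem target_le (ω : ℕ → ℕ) (t : ℕ) : target ω t ≤ t := by
  induction t using Nat.strong_induction_on with
  | _ t ih =>
    rcases lt_or_ge (ω t) t with h | h
    · rw [target_of_lt h]
      exact (ih _ h).trans h.le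
    · rw [target_of_le h]
      exact min_le_right _ _

theorem target_congr {ω ω' : ℕ → ℕ} {t : ℕ} (h : ∀ i ≤ t, ω i = ω' i) :
    target ω t = target ω' t := by
  induction t using Nat.strong_induction_on with
  | _ t ih =>
    have ht := h t le_rfl
    rcases lt_or_ge (ω t) t with hl | hl
    · rw [target_of_lt hl, target_of_lt (ω := ω') (by omega), ← ht]
      exact ih _ hl fun i hi => h i (hi.trans hl.le)
    · rw [target_of_le hl, target_of_le (ω := ω') (by omega), ht]

theorem ancestors_congr {ω ω' : ℕ → ℕ} {t : ℕ} (h : ∀ i ≤ t, ω i = ω' i) :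
    ancestors ω t = ancestors ω' t := by
  induction t using Nat.strong_induction_on with
  | _ t ih =>
    have ht := h t le_rfl
    rcases lt_or_ge (ω t) t with hl | hl
    · rw [ancestors_of_lt hl, ancestors_of_lt (ω := ω') (by omega), ← ht,
        ih _ hl fun i hi => h i (hi.trans hl.le)]
    · rw [ancestors_of_le hl, ancestors_of_le (ω := ω') (by omega)]

theorem target_update_of_lt (ω : ℕ → ℕ) {t N : ℕ} (c : ℕ) (h : t < N) :
    target (Function.update ω N c) t = target ω t :=
  target_congr fun i hi => Function.update_of_ne (by omega) _ _

theorem ancestors_update_of_lt (ω : ℕ → ℕ) {t N : ℕ} (c : ℕ) (h : t < N) :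
    ancestors (Function.update ω N c) t = ancestors ω t :=
  ancestors_congr fun i hi => Function.update_of_ne (by omega) _ _

theorem target_update_self_of_lt (ω : ℕ → ℕ) {N c : ℕ} (h : c < N) :
    target (Function.update ω N c) N = target ω c := by
  rw [target_of_lt (by simpa using h), Function.update_self, target_update_of_lt ω c h]

theorem target_update_self_add (ω : ℕ → ℕ) {N s : ℕ} (h : s ≤ N) :
    target (Function.update ω N (N + s)) N = s := by
  rw [target_of_le (by simp), Function.update_self]
  omega

theorem ancestors_update_self_of_lt (ω : ℕ → ℕ) {N c : ℕ} (h : c < N) :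
    ancestors (Function.update ω N c) N = insert N (ancestors ω c) := by
  rw [ancestors_of_lt (by simpa using h), Function.update_self, ancestors_update_of_lt ω c h]

theorem ancestors_update_self_add (ω : ℕ → ℕ) (N s : ℕ) :
    ancestors (Function.update ω N (N + s)) N = {N} :=
  ancestors_of_le (by simp)

theorem le_of_mem_ancestors {ω : ℕ → ℕ} {t e : ℕ} (h : t ∈ ancestors ω e) : t ≤ e := by
  induction e using Nat.strong_induction_on with
  | _ e ih =>
    rcases lt_or_ge (ω e) e with hl | hl
    · rw [ancestors_of_lt hl, Finset.mem_insert] at h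
      rcases h with rfl | h
      · rfl
      · exact (ih _ hl h).trans hl.le
    · rw [ancestors_of_le hl, Finset.mem_singleton] at h
      exact h.le

theorem target_eq_of_mem_ancestors {ω : ℕ → ℕ} {t e : ℕ} (h : t ∈ ancestors ω e) :
    target ω e = target ω t := by
  induction e using Nat.strong_induction_on with
  | _ e ih =>
    rcases lt_or_ge (ω e) e with hl | hl
    · rw [ancestors_of_lt hl, Finset.mem_insert] at h
      rcases h with rfl | h
      · rfl
      · rw [target_of_lt hl, ih _ hl h]
    · rw [ancestors_of_le hl, Finset.mem_singleton] at h
      rw [h]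

theorem target_update_of_mem {ω : ℕ → ℕ} {t e : ℕ} (c : ℕ) (h : t ∈ ancestors ω e) :
    target (Function.update ω t c) e = target (Function.update ω t c) t := by
  induction e using Nat.strong_induction_on with
  | _ e ih =>
    by_cases het : t = e
    · rw [het]
    · have hu : Function.update ω t c e = ω e := Function.update_of_ne (Ne.symm het) _ _
      rcases lt_or_ge (ω e) e with hl | hl
      · rw [ancestors_of_lt hl, Finset.mem_insert, or_iff_right het] at h
        rw [target_of_lt (hu ▸ hl), hu, ih _ hl h]
      · rw [ancestors_of_le hl, Finset.mem_singleton] at h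
        exact absurd h het

theorem target_update_of_notMem {ω : ℕ → ℕ} {t e : ℕ} (c : ℕ) (h : t ∉ ancestors ω e) :
    target (Function.update ω t c) e = target ω e := by
  induction e using Nat.strong_induction_on with
  | _ e ih =>
    have het : e ≠ t := fun h' => h (h' ▸ self_mem_ancestors ω e)
    have hu : Function.update ω t c e = ω e := Function.update_of_ne het _ _
    rcases lt_or_ge (ω e) e with hl | hl
    · rw [ancestors_of_lt hl, Finset.mem_insert, not_or] at h
      rw [target_of_lt (hu ▸ hl), hu, ih _ hl h.2, target_of_lt hl]
    · rw [target_of_le (hu ▸ hl), hu, target_of_le hl]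

end Target

/-! ### The independent choices reproduce the law of the graph. -/

section Law

variable {a : ℝ}

theorem sum_bind_mul {α β : Type*} [Fintype α] [Fintype β] (p : PMF α) (q : α → PMF β)
    (G : β → ℝ) :
    ∑ b, (p.bind q b).toReal * G b = ∑ x, (p x).toReal * ∑ b, (q x b).toReal * G b := by
  have h (b : β) : (p.bind q b).toReal = ∑ x, (p x).toReal * (q x b).toReal := by
    rw [PMF.bind_apply, tsum_fintype, ENNReal.toReal_sum]
    · simp only [ENNReal.toReal_mul]
    · exact fun x _ => ENNReal.mul_ne_top (p.apply_ne_top x) ((q x).apply_ne_top b)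
  simp only [h, Finset.sum_mul, Finset.mul_sum]
  rw [Finset.sum_comm]
  simp only [mul_assoc]

theorem sum_map_mul {α β : Type*} [Fintype α] [Fintype β] (p : PMF α) (g : α → β) (G : β → ℝ) :
    ∑ b, (p.map g b).toReal * G b = ∑ x, (p x).toReal * G (g x) := by
  classical
  rw [← PMF.bind_pure_comp, sum_bind_mul]
  refine Finset.sum_congr rfl fun x _ => ?_
  rw [Finset.sum_eq_single (g x)]
  · simp
  · intro b _ hb
    simp [PMF.pure_apply, hb]
  · simp

/-- The endpoints of the first `N` edges. -/
def targetFin (ω : ℕ → ℕ) (N : ℕ) (i : Fin N) : Fin N :=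
  ⟨target ω i, (target_le ω i).trans_lt i.2⟩

theorem targetFin_update (ω : ℕ → ℕ) (N c : ℕ) :
    targetFin (Function.update ω N c) (N + 1) =
      Fin.snoc (α := fun _ => Fin (N + 1)) (fun i => (targetFin ω N i).castSucc)
        ⟨target (Function.update ω N c) N, Nat.lt_succ_of_le (target_le _ N)⟩ := by
  funext i
  refine Fin.lastCases ?_ (fun i => ?_) i
  · simp [targetFin]
  · rw [Fin.snoc_castSucc]
    exact Fin.ext (target_update_of_lt ω c i.2)

/-- Each vertex is the source of exactly one edge, so `d(s) - 1` counts the edges with endpoint `s`.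
Choosing `s` with weight `d(s) - 1` thus amounts to copying the endpoint of a uniform edge. -/
theorem sum_attachProb_mul (N : ℕ) (f : Fin N → Fin N) (G : Fin (N + 1) → ℝ) :
    ∑ s, attachProb a f s * G s =
      (∑ j, G (f j).castSucc + a * ∑ s, G s) / ((a + 1) * ((N : ℝ) + 1) - 1) := by
  classical
  have hdeg (s : Fin N) : ((graphOne f).degree s : ℝ) - 1 = ∑ j, if f j = s then (1 : ℝ) else 0 := by
    have h1 : (Finset.univ.filter fun e => (graphOne f).src e = s) = {s} := by
      ext e
      rw [Finset.mem_filter, Finset.mem_singleton]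
      exact and_iff_right (Finset.mem_univ _)
    have : (graphOne f).degree s = 1 + (Finset.univ.filter fun e => f e = s).card := by
      unfold Multigraph.degree
      congr 1
      · rw [← Finset.card_singleton s, ← h1]
        congr
      · congr
    rw [this, Finset.sum_boole]
    push_cast
    ring
  have hcopy : ∑ s : Fin N, ((graphOne f).degree s - 1 : ℝ) * G s.castSucc =
      ∑ j, G (f j).castSucc := by
    simp only [hdeg, Finset.sum_mul, ite_mul, one_mul, zero_mul]
    rw [Finset.sum_comm]
    exact Finset.sum_congr rfl fun j _ => by simp
  unfold attachProb
  simp only [div_mul_eq_mul_div]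
  rw [← Finset.sum_div, Fin.sum_univ_castSucc, Fin.sum_univ_castSucc]
  congr 1
  simp only [Fin.lastCases_castSucc, Fin.lastCases_last, add_mul, Finset.sum_add_distrib, hcopy,
    mul_add, Finset.mul_sum]
  ring

theorem sum_law_mul (ha : 0 < a) (N : ℕ) (G : (Fin N → Fin N) → ℝ) :
    ∑ f, (law ha N f).toReal * G f = expect a N fun ω => G (targetFin ω N) := by
  induction N with
  | zero =>
    rw [Finset.sum_eq_single id]
    · simp only [law, PMF.pure_apply, expect]
      rw [Subsingleton.elim (targetFin 0 0) id]
      simp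
    · exact fun b _ hb => absurd (Subsingleton.elim _ _) hb
    · exact fun h => absurd (Finset.mem_univ _) h
  | succ N ih =>
    rw [law, sum_bind_mul, ih, expect_succ]
    congr 1
    funext ω
    rw [sum_map_mul]
    have h (s : Fin (N + 1)) : (attach ha (targetFin ω N) s).toReal =
        attachProb a (targetFin ω N) s :=
      ENNReal.toReal_ofReal (attachProb_nonneg ha _ s)
    simp only [h, targetFin_update]
    rw [sum_attachProb_mul, sum_weight_mul, Finset.sum_range, Finset.sum_range]
    congr 3
    · funext j
      congr 2
      exact Fin.ext (target_update_self_of_lt ω j.2).symm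
    · refine Finset.sum_congr rfl fun s _ => ?_
      congr 2
      exact Fin.ext (target_update_self_add ω (Nat.le_of_lt_succ s.2)).symm

theorem integral_prob (ha : 0 < a) (m n : ℕ) (G : (Fin (n * m) → Fin (n * m)) → ℝ) :
    ∫ f, G f ∂(prob ha m n) = expect a (n * m) fun ω => G (targetFin ω (n * m)) := by
  rw [prob, PMF.integral_eq_sum, ← sum_law_mul ha]
  rfl

open Classical in
theorem prob_real (ha : 0 < a) (m n : ℕ) (S : Set (Fin (n * m) → Fin (n * m))) :
    (prob ha m n).real S =
      expect a (n * m) fun ω => if targetFin ω (n * m) ∈ S then 1 else 0 := by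
  rw [← integral_prob ha m n fun f => if f ∈ S then 1 else 0,
    ← integral_indicator_one S.toFinite.measurableSet]
  rfl

end Law

/-! ### Moments of ancestors, descendants and indegrees. -/

section Moments

variable {a : ℝ}

theorem expect_eq_of_forall_update {K N : ℕ} (ha : 0 < a) (hKN : K ≤ N) (g : (ℕ → ℕ) → ℝ)
    (hg : ∀ M, K ≤ M → ∀ ω c, g (Function.update ω M c) = g ω) :
    expect a N g = expect a K g := by
  induction N, hKN using Nat.le_induction with
  | base => rfl
  | succ N hN ih =>
    rw [← ih, expect_succ]
    simp only [hg N hN, ← Finset.sum_mul, sum_weight ha, one_mul]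

theorem sum_range_succ_sq (e : ℕ) :
    ∑ c ∈ Finset.range e, ((c : ℝ) + 1) ^ 2 = (e : ℝ) * (e + 1) * (2 * e + 1) / 6 := by
  induction e with
  | zero => simp
  | succ e ih => rw [Finset.sum_range_succ, ih]; push_cast; ring

/-- Copying edge `c` lengthens its chain by one, hence at most doubles `2 ^ |ancestors|`; any other
choice resets the chain to length one. The resulting recursion over `c < e` is closed by the sum of
squares. -/
theorem expect_two_pow_card_ancestors_le (ha : 0 < a) {e N : ℕ} (heN : e < N) :
    expect a N (fun ω => (2 : ℝ) ^ (ancestors ω e).card) ≤ 2 * ((e : ℝ) + 1) ^ 2 := by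
  induction e using Nat.strong_induction_on generalizing N with
  | _ e ih =>
    rw [expect_eq_of_forall_update ha (K := e + 1) heN _
      fun M hM ω c => by rw [ancestors_update_of_lt ω c (by omega)], expect_succ]
    have hden := denom_pos ha e
    set den := (a + 1) * ((e : ℝ) + 1) - 1 with hd
    have h1 : ∀ ω, ∑ c ∈ Finset.range (2 * e + 1), weight a e c *
        (2 : ℝ) ^ (ancestors (Function.update ω e c) e).card ≤
        2 / den * (∑ c ∈ Finset.range e, (2 : ℝ) ^ (ancestors ω c).card + a * (e + 1)) := by
      intro ω
      rw [sum_weight_mul, ← hd, div_mul_eq_mul_div, mul_add, Finset.mul_sum _ _ (2 : ℝ)]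
      refine div_le_div_of_nonneg_right (add_le_add ?_ ?_) hden.le
      · refine Finset.sum_le_sum fun c hc => ?_
        rw [ancestors_update_self_of_lt ω (Finset.mem_range.mp hc), ← pow_succ']
        exact pow_le_pow_right₀ (by norm_num) (Finset.card_insert_le _ _)
      · simp only [ancestors_update_self_add]
        simp
        apply le_of_eq
        ring
    refine (expect_mono ha e h1).trans ?_
    rw [expect_const_mul, expect_add, expect_sum, expect_const ha]
    have h2 : ∑ c ∈ Finset.range e, expect a e (fun ω => (2 : ℝ) ^ (ancestors ω c).card) ≤
        2 * (e * (e + 1) * (2 * e + 1) / 6) := by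
      rw [← sum_range_succ_sq, Finset.mul_sum]
      exact Finset.sum_le_sum fun c hc => ih c (Finset.mem_range.mp hc) (Finset.mem_range.mp hc)
    rw [div_mul_eq_mul_div, div_le_iff₀ hden, hd]
    have he : (0 : ℝ) ≤ e := e.cast_nonneg
    nlinarith [mul_nonneg he he, mul_nonneg he ha.le, mul_nonneg (mul_nonneg he he) ha.le,
      mul_nonneg (mul_nonneg he he) he, mul_nonneg (mul_nonneg (mul_nonneg he he) he) ha.le]

/-- The edges among the first `N` whose endpoint is determined by that of the edge `t`. -/
def descendants (ω : ℕ → ℕ) (N t : ℕ) : Finset ℕ :=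
  (Finset.range N).filter fun e => t ∈ ancestors ω e

theorem card_descendants (ω : ℕ → ℕ) (N t : ℕ) :
    ((descendants ω N t).card : ℝ) =
      ∑ e ∈ Finset.range N, if t ∈ ancestors ω e then (1 : ℝ) else 0 := by
  rw [Finset.sum_boole, descendants]

theorem descendants_succ_self (ω : ℕ → ℕ) (t : ℕ) : descendants ω (t + 1) t = {t} := by
  ext e
  simp only [descendants, Finset.mem_filter, Finset.mem_range, Finset.mem_singleton]
  constructor
  · rintro ⟨h1, h2⟩
    have := le_of_mem_ancestors h2
    omega
  · rintro rfl
    exact ⟨Nat.lt_succ_self _, self_mem_ancestors ω e⟩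

theorem card_descendants_update (ω : ℕ → ℕ) (N t c : ℕ) :
    ((descendants (Function.update ω N c) (N + 1) t).card : ℝ) = (descendants ω N t).card +
      if t ∈ ancestors (Function.update ω N c) N then (1 : ℝ) else 0 := by
  rw [card_descendants, card_descendants, Finset.sum_range_succ]
  congr 1
  refine Finset.sum_congr rfl fun e he => ?_
  rw [ancestors_update_of_lt ω c (Finset.mem_range.mp he)]

/-- With `Z` descendants present, the new edge joins them with probability `Z / den`, which raises
`Z (Z + 1)` by `2 (Z + 1)`. This choice of quadratic makes the recursion exactly multiplicative. -/
theorem expect_card_descendants_succ (ha : 0 < a) {t N : ℕ} (h : t < N) :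
    expect a (N + 1) (fun ω => ((descendants ω (N + 1) t).card : ℝ) *
      ((descendants ω (N + 1) t).card + 1)) =
    (1 + 2 / ((a + 1) * ((N : ℝ) + 1) - 1)) * expect a N (fun ω =>
      ((descendants ω N t).card : ℝ) * ((descendants ω N t).card + 1)) := by
  rw [expect_succ, ← expect_const_mul]
  congr 1
  funext ω
  have hden := (denom_pos ha N).ne'
  rw [sum_weight_mul]
  simp only [card_descendants_update, ancestors_update_self_add, Finset.mem_singleton, h.ne,
    if_false, add_zero]
  set Z : ℝ := ((descendants ω N t).card : ℝ) with hZ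
  have h1 : ∑ c ∈ Finset.range N,
      (Z + if t ∈ ancestors (Function.update ω N c) N then (1 : ℝ) else 0) *
        (Z + (if t ∈ ancestors (Function.update ω N c) N then (1 : ℝ) else 0) + 1) =
      N * (Z * (Z + 1)) + 2 * (Z + 1) * Z := by
    nth_rewrite 6 [hZ]
    rw [card_descendants, Finset.mul_sum]
    have : (N : ℝ) * (Z * (Z + 1)) = ∑ c ∈ Finset.range N, Z * (Z + 1) := by simp
    rw [this, ← Finset.sum_add_distrib]
    refine Finset.sum_congr rfl fun c hc => ?_
    rw [ancestors_update_self_of_lt ω (Finset.mem_range.mp hc), ite_congr (propext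
      (Finset.mem_insert.trans (or_iff_right h.ne))) (fun _ => rfl) (fun _ => rfl)]
    split_ifs <;> ring
  rw [h1, Finset.sum_const, Finset.card_range, nsmul_eq_mul]
  push_cast
  generalize hD : (a + 1) * ((N : ℝ) + 1) - 1 = D at hden ⊢
  field_simp
  rw [← hD]
  ring

theorem expect_card_descendants_le (ha : 0 < a) {q : ℝ} (hq : 1 ≤ q) (hqa : 2 / (1 + a) ≤ q)
    {t N : ℕ} (h : t < N) :
    expect a N (fun ω => ((descendants ω N t).card : ℝ) * ((descendants ω N t).card + 1)) ≤
      2 * ((N : ℝ) / (t + 1)) ^ q := by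
  induction N, Nat.succ_le_of_lt h using Nat.le_induction with
  | base =>
    simp only [Nat.succ_eq_add_one, descendants_succ_self, Finset.card_singleton, expect_const ha]
    push_cast
    rw [div_self (by positivity), Real.one_rpow]
    norm_num
  | succ N hN ih =>
    rw [expect_card_descendants_succ ha hN]
    have hN0 : (0 : ℝ) < N := by exact_mod_cast (Nat.zero_le t).trans_lt hN
    -- Bernoulli's inequality for the exponent `q ≥ 1`, using that the denominator is at least `(1 +
    -- a) N`.
    have hf : 1 + 2 / ((a + 1) * ((N : ℝ) + 1) - 1) ≤ (((N : ℝ) + 1) / N) ^ q := by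
      have h1 : ((N : ℝ) + 1) / N = 1 + 1 / N := by field_simp
      rw [h1]
      refine le_trans ?_ (one_add_mul_self_le_rpow_one_add
        (s := 1 / (N : ℝ)) (le_trans (b := 0) (by norm_num) (by positivity)) hq)
      have h2 : 2 / ((a + 1) * ((N : ℝ) + 1) - 1) ≤ 2 / ((1 + a) * N) :=
        div_le_div_of_nonneg_left (by norm_num) (by positivity) (by nlinarith)
      have h3 : 2 / ((1 + a) * N) = 2 / (1 + a) * (1 / N) := by field_simp
      have h4 := mul_le_mul_of_nonneg_right hqa (show 0 ≤ 1 / (N : ℝ) by positivity)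
      linarith
    refine (mul_le_mul hf (ih hN) ?_ (by positivity)).trans (le_of_eq ?_)
    · rw [← expect_const ha N 0]
      exact expect_mono ha N fun ω => by positivity
    · rw [mul_left_comm, ← Real.mul_rpow (by positivity) (by positivity)]
      push_cast
      congr 2
      field_simp

theorem sum_expect_sq_card_descendants_le (ha : 0 < a) {q : ℝ} (hq : 1 ≤ q)
    (hqa : 2 / (1 + a) ≤ q) (N : ℕ) :
    ∑ t ∈ Finset.range N, expect a N (fun ω => ((descendants ω N t).card : ℝ) ^ 2) ≤
      2 * (N : ℝ) ^ q * (1 + Real.log N) := by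
  have h1 : ∀ t ∈ Finset.range N, expect a N (fun ω => ((descendants ω N t).card : ℝ) ^ 2) ≤
      2 * (N : ℝ) ^ q * (1 / ((t : ℝ) + 1)) := by
    intro t ht
    refine (expect_mono ha N fun ω => ?_).trans
      ((expect_card_descendants_le ha hq hqa (Finset.mem_range.mp ht)).trans ?_)
    · have : (0 : ℝ) ≤ (descendants ω N t).card := Nat.cast_nonneg _
      nlinarith
    · rw [Real.div_rpow (by positivity) (by positivity), mul_assoc, ← div_eq_mul_one_div]
      refine mul_le_mul_of_nonneg_left (div_le_div_of_nonneg_left (by positivity) (by positivity)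
        ?_) (by norm_num)
      -- As `q ≥ 1`, `(t + 1) ^ q` may be replaced by `t + 1`, which leaves a harmonic sum.
      exact Real.self_le_rpow_of_one_le (by linarith [(t.cast_nonneg : (0 : ℝ) ≤ t)]) hq
  refine (Finset.sum_le_sum h1).trans ?_
  rw [← Finset.mul_sum]
  refine mul_le_mul_of_nonneg_left ?_ (by positivity)
  have := harmonic_le_one_add_log N
  simpa [harmonic] using this

/-- The number of the first `N` edges whose endpoint is `u`. -/
def indegree (ω : ℕ → ℕ) (N u : ℕ) : ℕ := ((Finset.range N).filter fun e => target ω e = u).card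

theorem cast_indegree (ω : ℕ → ℕ) (N u : ℕ) : (indegree ω N u : ℝ) =
    ∑ e ∈ Finset.range N, if target ω e = u then (1 : ℝ) else 0 := by
  rw [Finset.sum_boole, indegree]

/-- The new edge chooses `u` with total weight indegree plus `a`, so this shifted indegree grows by
an exact factor. The case `u = N` is included because a new vertex may choose itself. -/
theorem expect_indegree_succ (ha : 0 < a) {u N : ℕ} (h : u ≤ N) :
    expect a (N + 1) (fun ω => (indegree ω (N + 1) u : ℝ) + a) =
    (1 + 1 / ((a + 1) * ((N : ℝ) + 1) - 1)) *
      expect a N (fun ω => (indegree ω N u : ℝ) + a) := by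
  rw [expect_succ, ← expect_const_mul]
  congr 1
  funext ω
  have hden := (denom_pos ha N).ne'
  have hI (c : ℕ) : (indegree (Function.update ω N c) (N + 1) u : ℝ) = indegree ω N u +
      if target (Function.update ω N c) N = u then (1 : ℝ) else 0 := by
    rw [cast_indegree, cast_indegree, Finset.sum_range_succ]
    congr 1
    refine Finset.sum_congr rfl fun e he => ?_
    rw [target_update_of_lt ω c (Finset.mem_range.mp he)]
  rw [sum_weight_mul]
  have h1 : ∑ c ∈ Finset.range N, ((indegree (Function.update ω N c) (N + 1) u : ℝ) + a) =
      N * (indegree ω N u + a) + indegree ω N u := by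
    nth_rewrite 2 [cast_indegree]
    have : (N : ℝ) * (indegree ω N u + a) = ∑ c ∈ Finset.range N, ((indegree ω N u : ℝ) + a) := by
      rw [Finset.sum_const, Finset.card_range, nsmul_eq_mul]
    rw [this, ← Finset.sum_add_distrib]
    refine Finset.sum_congr rfl fun c hc => ?_
    rw [hI, target_update_self_of_lt ω (Finset.mem_range.mp hc)]
    ring
  have h2 : ∑ s ∈ Finset.range (N + 1),
      ((indegree (Function.update ω N (N + s)) (N + 1) u : ℝ) + a) =
      (N + 1) * (indegree ω N u + a) + 1 := by
    have e1 : ((N : ℝ) + 1) * (indegree ω N u + a) =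
        ∑ c ∈ Finset.range (N + 1), ((indegree ω N u : ℝ) + a) := by
      rw [Finset.sum_const, Finset.card_range, nsmul_eq_mul]
      push_cast
      rfl
    have e2 : (1 : ℝ) = ∑ s ∈ Finset.range (N + 1), if u = s then (1 : ℝ) else 0 := by
      rw [Finset.sum_ite_eq, if_pos (by simpa using Nat.lt_succ_of_le h)]
    nth_rewrite 2 [e2]
    rw [e1, ← Finset.sum_add_distrib]
    refine Finset.sum_congr rfl fun s hs => ?_
    rw [hI, target_update_self_add ω (Nat.le_of_lt_succ (Finset.mem_range.mp hs))]
    simp only [eq_comm]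
    ring
  rw [h1, h2]
  generalize hD : (a + 1) * ((N : ℝ) + 1) - 1 = D at hden ⊢
  field_simp
  rw [← hD]
  ring

theorem le_expect_indegree (ha : 0 < a) {u N : ℕ} (h : u ≤ N) :
    a * (((N : ℝ) + 1) / (u + 1)) ^ (1 / (1 + a)) ≤
      expect a N (fun ω => (indegree ω N u : ℝ) + a) := by
  induction N, h using Nat.le_induction with
  | base =>
    rw [div_self (by positivity), Real.one_rpow, mul_one]
    nth_rewrite 1 [← expect_const ha u a]
    exact expect_mono ha u fun ω => by simp
  | succ N hN ih =>
    rw [expect_indegree_succ ha hN]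
    have hden := denom_pos ha N
    -- Bernoulli's inequality again, now reversed since the exponent is at most 1.
    have hf : (((N : ℝ) + 1 + 1) / (N + 1)) ^ (1 / (1 + a)) ≤
        1 + 1 / ((a + 1) * ((N : ℝ) + 1) - 1) := by
      have h1 : ((N : ℝ) + 1 + 1) / (N + 1) = 1 + 1 / (N + 1) := by field_simp
      rw [h1]
      refine (rpow_one_add_le_one_add_mul_self (s := 1 / ((N : ℝ) + 1))
        (le_trans (b := 0) (by norm_num) (by positivity)) (by positivity) ?_).trans ?_
      · rw [div_le_one (by positivity)]; linarith
      · have h2 : 1 / (1 + a) * (1 / ((N : ℝ) + 1)) = 1 / ((a + 1) * (N + 1)) := by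
          field_simp
          ring
        rw [h2]
        gcongr
        linarith
    refine le_trans (le_of_eq ?_) (mul_le_mul hf ih (by positivity) (by positivity))
    rw [mul_left_comm, ← Real.mul_rpow (by positivity) (by positivity)]
    push_cast
    congr 2
    field_simp

end Moments

end BuckleyOsthus

/-! ### Second degrees in a deterministic multigraph: moving edges and counting `k`-vertices. -/

namespace Multigraph

section SecondDegree

open Classical

variable {V E : Type*} (G G' : Multigraph V E)

theorem Joins.incident_right {G : Multigraph V E} {e : E} {u v : V} (h : G.Joins e u v) :
    G.Incident e v := by
  rcases h with h | h
  · exact Or.inr h.2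
  · exact Or.inl h.1

/-- The edges counted by the second degree. -/
noncomputable def secondEdges [Fintype E] (t : V) : Finset E :=
  Finset.univ.filter fun e => ¬ G.Incident e t ∧ ∃ i, G.Neighbor i t ∧ G.Incident e i

theorem mem_secondEdges [Fintype E] {t : V} {e : E} :
    e ∈ G.secondEdges t ↔ ¬ G.Incident e t ∧ ∃ i, G.Neighbor i t ∧ G.Incident e i := by
  simp [secondEdges]

theorem secondDegree_eq_card [Fintype E] (t : V) :
    G.secondDegree t = (G.secondEdges t).card := rfl

/-- A set of `k` edges counted by the second degree of a `k`-vertex. -/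
noncomputable def certificate [Fintype E] (k : ℕ) (t : V) : Finset E :=
  if h : k ≤ (G.secondEdges t).card then (Finset.exists_subset_card_eq h).choose else ∅

theorem certificate_subset [Fintype E] (k : ℕ) (t : V) :
    G.certificate k t ⊆ G.secondEdges t := by
  unfold certificate
  split_ifs with h
  · exact (Finset.exists_subset_card_eq h).choose_spec.1
  · exact Finset.empty_subset _

theorem card_certificate [Fintype E] {k : ℕ} {t : V} (h : k ≤ G.secondDegree t) :
    (G.certificate k t).card = k := by
  rw [secondDegree_eq_card] at h
  unfold certificate
  rw [dif_pos h]
  exact (Finset.exists_subset_card_eq h).choose_spec.2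

/-- The number of `k`-vertices whose certificate meets `D`. -/
noncomputable def numSensitive [Fintype V] [Fintype E] (k : ℕ) (D : Finset E) : ℕ :=
  (Finset.univ.filter fun w =>
    k ≤ G.secondDegree w ∧ ¬ Disjoint (G.certificate k w) D).card

/-- `G'` arises from `G` by moving the ends of the edges in `D` from `u` to `v`. -/
structure IsMove (D : Finset E) (u v : V) : Prop where
  src_eq : G'.src = G.src
  tgt_eq : ∀ e ∉ D, G'.tgt e = G.tgt e
  tgt_left : ∀ e ∈ D, G.tgt e = u
  tgt_right : ∀ e ∈ D, G'.tgt e = v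

namespace IsMove

variable {G G'} {D : Finset E} {u v : V}

theorem symm (h : G.IsMove G' D u v) : G'.IsMove G D v u :=
  ⟨h.src_eq.symm, fun e he => (h.tgt_eq e he).symm, h.tgt_right, h.tgt_left⟩

theorem not_incident (h : G.IsMove G' D u v) {w : V} (hw : w ∉ D.image G.src) (hu : w ≠ u)
    {e : E} (he : e ∈ D) : ¬ G.Incident e w := by
  rintro (h' | h')
  · exact hw (Finset.mem_image.mpr ⟨e, he, h'⟩)
  · exact hu (h' ▸ h.tgt_left e he)

theorem incident_iff (h : G.IsMove G' D u v) {e : E} (he : e ∉ D) (w : V) :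
    G'.Incident e w ↔ G.Incident e w := by
  unfold Incident
  rw [h.src_eq, h.tgt_eq e he]

theorem neighbor_mono (h : G.IsMove G' D u v) {w : V} (hw : w ∉ D.image G.src) (hu : w ≠ u)
    {i : V} (hi : G.Neighbor i w) : G'.Neighbor i w := by
  obtain ⟨hne, e, he⟩ := hi
  have heD : e ∉ D := fun heD => h.not_incident hw hu heD he.incident_right
  refine ⟨hne, e, ?_⟩
  unfold Joins at he ⊢
  rwa [h.src_eq, h.tgt_eq e heD]

theorem mem_secondEdges [Fintype E] (h : G.IsMove G' D u v) {w : V} (hw : w ∉ D.image G.src)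
    (hu : w ≠ u) {e : E} (heD : e ∉ D) (he : e ∈ G.secondEdges w) : e ∈ G'.secondEdges w := by
  rw [Multigraph.mem_secondEdges] at he ⊢
  obtain ⟨h1, i, h2, h3⟩ := he
  exact ⟨fun h' => h1 ((h.incident_iff heD w).mp h'), i, h.neighbor_mono hw hu h2,
    (h.incident_iff heD i).mpr h3⟩

/-- The sources of `D` and the vertices `u`, `v` give `|D| + 2`. Any other vertex keeps its
neighbours and all its second edges outside `D`, so it can be lost only if its certificate meets
`D`. It must also be a neighbour of `u`, and the edges that remain at `u` would save it if there
were too many of them. -/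
theorem card_lost_le [Fintype V] [Fintype E] (h : G.IsMove G' D u v) {m : ℕ}
    (hm : ∀ x, (Finset.univ.filter fun e => G.src e = x).card ≤ m) (k : ℕ) :
    (Finset.univ.filter fun w => k ≤ G.secondDegree w ∧ ¬ k ≤ G'.secondDegree w).card ≤
      D.card + 2 + min (G.numSensitive k D) (k + 2 * m) := by
  set L := Finset.univ.filter fun w => k ≤ G.secondDegree w ∧ ¬ k ≤ G'.secondDegree w with hL
  set B := L.filter fun w => w ∉ D.image G.src ∧ w ≠ u ∧ w ≠ v with hB
  have hsub : L ⊆ D.image G.src ∪ {u, v} ∪ B := by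
    intro w hw
    simp only [Finset.mem_union, Finset.mem_insert, Finset.mem_singleton, hB, Finset.mem_filter]
    tauto
  have hmemB {w : V} (hw : w ∈ B) : k ≤ (G.secondEdges w).card ∧ (G'.secondEdges w).card < k ∧
      w ∉ D.image G.src ∧ w ≠ u ∧ w ≠ v := by
    simp only [hB, hL, Finset.mem_filter, Finset.mem_univ, true_and, secondDegree_eq_card,
      not_le] at hw
    tauto
  have hw' {w : V} (hw : w ∉ D.image G.src) : w ∉ D.image G'.src := by rwa [h.src_eq]
  have hcert : B.card ≤ G.numSensitive k D := by
    refine Finset.card_le_card fun w hw => ?_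
    obtain ⟨h1, h2, h3, h4, h5⟩ := hmemB hw
    simp only [Finset.mem_filter, Finset.mem_univ, true_and]
    refine ⟨h1, fun hd => h2.not_ge ?_⟩
    rw [← G.card_certificate h1]
    refine Finset.card_le_card fun e he => ?_
    exact h.mem_secondEdges h3 h4 (Finset.disjoint_left.mp hd he) (G.certificate_subset k w he)
  -- If `u` is not a neighbour of `w`, an edge of `D` is counted for `w` through its source, which
  -- does not move.
  have hnbr {w : V} (hw : w ∈ B) : G.Neighbor u w := by
    obtain ⟨h1, h2, h3, h4, h5⟩ := hmemB hw
    by_contra hn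
    refine h2.not_ge (h1.trans (Finset.card_le_card fun e he => ?_))
    by_cases heD : e ∈ D
    · rw [Multigraph.mem_secondEdges] at he ⊢
      obtain ⟨-, i, hi, hei⟩ := he
      refine ⟨h.symm.not_incident (hw' h3) h5 heD, i, h.neighbor_mono h3 h4 hi, ?_⟩
      rcases hei with hs | ht
      · exact Or.inl (by rw [h.src_eq, hs])
      · exact absurd ((ht.symm.trans (h.tgt_left e heD)) ▸ hi) hn
    · exact h.mem_secondEdges h3 h4 heD he
  have hdeg : B.card ≤ k + 2 * m := by
    rcases B.eq_empty_or_nonempty with hE | ⟨w₀, hw₀⟩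
    · simp [hE]
    set F := Finset.univ.filter fun e => e ∉ D ∧ G.Incident e u with hF
    have h1 : B ⊆ F.image fun e => if G.src e = u then G.tgt e else G.src e := by
      intro w hw
      obtain ⟨-, -, h3, h4, -⟩ := hmemB hw
      obtain ⟨hne, e, he⟩ := hnbr hw
      refine Finset.mem_image.mpr ⟨e, ?_, ?_⟩
      · simp only [hF, Finset.mem_filter, Finset.mem_univ, true_and]
        refine ⟨fun heD => h.not_incident h3 h4 heD he.incident_right, ?_⟩
        rcases he with he | he
        · exact Or.inl he.1
        · exact Or.inr he.2
      · rcases he with he | he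
        · rw [if_pos he.1, he.2]
        · rw [if_neg (he.1 ▸ h4), he.1]
    obtain ⟨-, h2, h3, h4, h5⟩ := hmemB hw₀
    -- Apart from edges sent by `u` or by `w₀`, the edges remaining at `u` are still second edges of
    -- the lost vertex `w₀`, so there are fewer than `k` of them.
    have h6 : F ⊆ G'.secondEdges w₀ ∪ ((Finset.univ.filter fun e => G.src e = u) ∪
        Finset.univ.filter fun e => G.src e = w₀) := by
      intro e he
      simp only [hF, Finset.mem_filter, Finset.mem_univ, true_and] at he
      simp only [Finset.mem_union, Finset.mem_filter, Finset.mem_univ, true_and]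
      by_cases hi : G.Incident e w₀
      · right
        rcases he.2 with hs | ht
        · exact Or.inl hs
        · rcases hi with hs' | ht'
          · exact Or.inr hs'
          · exact absurd (ht'.symm.trans ht) h4
      · left
        refine h.mem_secondEdges h3 h4 he.1 ((Multigraph.mem_secondEdges G).mpr
          ⟨hi, u, hnbr hw₀, he.2⟩)
    have h7 := (Finset.card_le_card h1).trans Finset.card_image_le
    have h8 := (Finset.card_le_card h6).trans ((Finset.card_union_le _ _).trans
      (Nat.add_le_add_left (Finset.card_union_le _ _) _))
    have h9 := hm u
    have h10 := hm w₀
    omega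
  calc L.card ≤ (D.image G.src ∪ {u, v} ∪ B).card := Finset.card_le_card hsub
    _ ≤ (D.image G.src).card + ({u, v} : Finset V).card + B.card :=
      (Finset.card_union_le _ _).trans (Nat.add_le_add_right (Finset.card_union_le _ _) _)
    _ ≤ _ := add_le_add (add_le_add Finset.card_image_le Finset.card_le_two) (le_min hcert hdeg)

theorem numKVertices_le [Fintype V] [Fintype E] (h : G.IsMove G' D u v) {m : ℕ}
    (hm : ∀ x, (Finset.univ.filter fun e => G.src e = x).card ≤ m) (k : ℕ) :
    G.numKVertices k ≤ G'.numKVertices k + (D.card + 2 + min (G.numSensitive k D) (k + 2 * m)) := by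
  refine le_trans ?_ (Nat.add_le_add_left (h.card_lost_le hm k) _)
  refine (Finset.card_le_card fun w hw => ?_).trans (Finset.card_union_le _ _)
  simp only [Finset.mem_filter, Finset.mem_univ, true_and, Finset.mem_union] at hw ⊢
  tauto

end IsMove

theorem numSensitive_le_sum [Fintype V] [Fintype E] (k : ℕ) (D : Finset E) :
    G.numSensitive k D ≤ ∑ w ∈ Finset.univ.filter (fun w => k ≤ G.secondDegree w),
      ∑ e ∈ G.certificate k w, if e ∈ D then 1 else 0 := by
  rw [numSensitive, ← Finset.filter_filter, Finset.card_filter]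
  refine Finset.sum_le_sum fun w _ => ?_
  by_cases hd : Disjoint (G.certificate k w) D
  · simp [hd]
  · rw [if_pos hd]
    obtain ⟨e, he, he'⟩ := Finset.not_disjoint_iff.mp hd
    exact (le_of_eq (by rw [if_pos he'])).trans
      (Finset.single_le_sum (f := fun e => if e ∈ D then 1 else 0) (fun _ _ => Nat.zero_le _) he)

/-- If at least `k + 2m` edges enter `u` from other vertices, each sender `t` sees all of them
except the at most `m` it sent itself, so `t` is a `k`-vertex. A vertex sends at most `m` edges, so
the edges entering such `u` number at most `m` times the `k`-vertices. The remaining `u` contribute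
negative terms. -/
theorem sum_card_sub_le_numKVertices [Fintype V] [Fintype E] {m : ℕ}
    (hm : ∀ x, (Finset.univ.filter fun e => G.src e = x).card ≤ m) (k : ℕ) (U : Finset V) :
    ∑ u ∈ U, (((Finset.univ.filter fun e => G.src e ≠ u ∧ G.tgt e = u).card : ℝ) -
      (k + 2 * m)) ≤ m * G.numKVertices k := by
  set I : V → Finset E := fun u => Finset.univ.filter fun e => G.src e ≠ u ∧ G.tgt e = u with hI
  set U' := U.filter fun u => k + 2 * m ≤ (I u).card with hU'
  set K := Finset.univ.filter fun t => k ≤ G.secondDegree t with hK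
  have h1 : ∑ u ∈ U, (((I u).card : ℝ) - (k + 2 * m)) ≤ ∑ u ∈ U', ((I u).card : ℝ) := by
    rw [hU', Finset.sum_filter]
    refine Finset.sum_le_sum fun u _ => ?_
    split_ifs with h
    · have : (0 : ℝ) ≤ k + 2 * m := by positivity
      linarith
    · have : ((I u).card : ℝ) ≤ k + 2 * m := by exact_mod_cast (not_le.mp h).le
      linarith
  have h2 : ∑ u ∈ U', (I u).card = (U'.biUnion I).card := by
    rw [Finset.card_biUnion]
    intro u _ u' _ hne
    refine Finset.disjoint_left.mpr fun e he he' => hne ?_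
    simp only [hI, Finset.mem_filter] at he he'
    rw [← he.2.2, he'.2.2]
  have h3 : U'.biUnion I ⊆ K.biUnion fun t => Finset.univ.filter fun e => G.src e = t := by
    intro e he
    obtain ⟨u, hu, heu⟩ := Finset.mem_biUnion.mp he
    simp only [hI, Finset.mem_filter, Finset.mem_univ, true_and] at heu
    refine Finset.mem_biUnion.mpr ⟨G.src e, ?_, by simp⟩
    simp only [hK, Finset.mem_filter, Finset.mem_univ, true_and]
    have hu' := (Finset.mem_filter.mp hu).2
    have hsub : I u ⊆ G.secondEdges (G.src e) ∪ ((Finset.univ.filter fun e => G.src e = u) ∪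
        Finset.univ.filter fun e' => G.src e' = G.src e) := by
      intro e' he'
      simp only [hI, Finset.mem_filter, Finset.mem_univ, true_and] at he'
      simp only [Finset.mem_union, Finset.mem_filter, Finset.mem_univ, true_and]
      by_cases hi : G.Incident e' (G.src e)
      · rcases hi with hs | ht
        · exact Or.inr (Or.inr hs)
        · exact absurd (ht.symm.trans he'.2) heu.1
      · exact Or.inl ((mem_secondEdges G).mpr
          ⟨hi, u, ⟨heu.1.symm, e, Or.inr ⟨rfl, heu.2⟩⟩, Or.inr he'.2⟩)
    have h8 := (Finset.card_le_card hsub).trans ((Finset.card_union_le _ _).trans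
      (Nat.add_le_add_left (Finset.card_union_le _ _) _))
    have h9 := hm u
    have h10 := hm (G.src e)
    rw [secondDegree_eq_card]
    omega
  have h4 : ∑ u ∈ U', (I u).card ≤ K.card * m := by
    rw [h2]
    refine (Finset.card_le_card h3).trans (Finset.card_biUnion_le_card_mul _ _ _ fun t _ => hm t)
  refine h1.trans ?_
  have h5 : (∑ u ∈ U', ((I u).card : ℝ)) ≤ K.card * m := by exact_mod_cast h4
  rw [mul_comm]
  exact h5

end SecondDegree

end Multigraph

namespace BuckleyOsthus

/-! ### Variance and mean of the number of `k`-vertices. -/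

section Merged

/-- The merged graph, as a function of the choices. -/
def merged (m n : ℕ) (ω : ℕ → ℕ) : Multigraph (Fin n) (Fin (n * m)) :=
  graphMerged (targetFin ω (n * m))

/-- The number of `k`-vertices, as a function of the choices. -/
noncomputable def numVertices (m n k : ℕ) (ω : ℕ → ℕ) : ℝ :=
  Y m n k (targetFin ω (n * m))

theorem numVertices_eq (m n k : ℕ) (ω : ℕ → ℕ) :
    numVertices m n k ω = ((merged m n ω).numKVertices k : ℝ) := rfl

theorem EY_eq_expect {a : ℝ} (ha : 0 < a) (m n k : ℕ) :
    EY ha m n k = expect a (n * m) (numVertices m n k) :=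
  integral_prob ha m n _

theorem card_src_fiber_le (m n : ℕ) (ω : ℕ → ℕ) (x : Fin n)
    [DecidablePred fun e => (merged m n ω).src e = x] :
    (Finset.univ.filter fun e => (merged m n ω).src e = x).card ≤ m := by
  have hval {e : Fin (n * m)} (he : e ∈ Finset.univ.filter fun e => (merged m n ω).src e = x) :
      (e : ℕ) / m = x := by
    rw [Finset.mem_filter] at he
    rw [← he.2]
    rfl
  rcases Nat.eq_zero_or_pos m with rfl | hm
  · exact (Finset.card_le_univ _).trans (by simp)
  · refine (Finset.card_le_card_of_injOn (t := Finset.range m)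
      (fun e : Fin (n * m) => (e : ℕ) % m) ?_ ?_).trans
      (Finset.card_range m).le
    · intro e _
      simpa using Nat.mod_lt _ hm
    · intro e he e' he' h
      refine Fin.ext ?_
      rw [← Nat.div_add_mod (e : ℕ) m, ← Nat.div_add_mod (e' : ℕ) m, hval he, hval he']
      simp only at h
      rw [h]

theorem isMove_update {m n t : ℕ} (ω : ℕ → ℕ) (c : ℕ) (ht : t < n * m) :
    (merged m n ω).IsMove (merged m n (Function.update ω t c))
      (Finset.univ.filter fun e : Fin (n * m) => t ∈ ancestors ω e)
      (targetFin ω (n * m) ⟨t, ht⟩).divNat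
      (targetFin (Function.update ω t c) (n * m) ⟨t, ht⟩).divNat where
  src_eq := rfl
  tgt_eq e he := by
    simp only [Finset.mem_filter, Finset.mem_univ, true_and] at he
    exact congrArg Fin.divNat (Fin.ext (target_update_of_notMem c he))
  tgt_left e he := by
    simp only [Finset.mem_filter, Finset.mem_univ, true_and] at he
    exact congrArg Fin.divNat (Fin.ext (target_eq_of_mem_ancestors he))
  tgt_right e he := by
    simp only [Finset.mem_filter, Finset.mem_univ, true_and] at he
    exact congrArg Fin.divNat (Fin.ext (target_update_of_mem c he))

theorem card_filter_mem_ancestors_le (ω : ℕ → ℕ) (N t : ℕ) :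
    (Finset.univ.filter fun e : Fin N => t ∈ ancestors ω e).card ≤ (descendants ω N t).card := by
  refine Finset.card_le_card_of_injOn (fun e => (e : ℕ)) ?_ Fin.val_injective.injOn
  intro e he
  simp only [Finset.coe_filter, Finset.mem_univ, true_and, Set.mem_ofPred_eq] at he
  simp [descendants, he]

/-- The number of `k`-vertices whose certificate contains an edge derived from the edge `t`. -/
noncomputable def numSensitive (m n k : ℕ) (ω : ℕ → ℕ) (t : ℕ) : ℕ :=
  (merged m n ω).numSensitive k (Finset.univ.filter fun e : Fin (n * m) => t ∈ ancestors ω e)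

theorem one_le_card_descendants {N t : ℕ} (ω : ℕ → ℕ) (ht : t < N) :
    1 ≤ (descendants ω N t).card :=
  Finset.card_pos.mpr ⟨t, by simp [descendants, ht, self_mem_ancestors]⟩

theorem sq_posPart_numVertices_sub_le {m n t : ℕ} (k : ℕ) (ω : ℕ → ℕ) (c : ℕ) (ht : t < n * m) :
    (max (numVertices m n k ω - numVertices m n k (Function.update ω t c)) 0) ^ 2 ≤
      18 * ((descendants ω (n * m) t).card : ℝ) ^ 2 +
        2 * (k + 2 * m) * (numSensitive m n k ω t : ℝ) := by
  have h := (isMove_update ω c ht).numKVertices_le (m := m) (fun x => by convert card_src_fiber_le m n ω x) k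
  have hZ := card_filter_mem_ancestors_le ω (n * m) t
  have hZ1 := one_le_card_descendants ω ht
  have hb1 := min_le_left (numSensitive m n k ω t) (k + 2 * m)
  have hb2 := min_le_right (numSensitive m n k ω t) (k + 2 * m)
  have h' : (merged m n ω).numKVertices k ≤
      (merged m n (Function.update ω t c)).numKVertices k +
        ((descendants ω (n * m) t).card + 2 + min (numSensitive m n k ω t) (k + 2 * m)) :=
    h.trans (Nat.add_le_add_left (Nat.add_le_add_right (Nat.add_le_add_right hZ 2) _) _)
  have hr : numVertices m n k ω - numVertices m n k (Function.update ω t c) ≤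
      (descendants ω (n * m) t).card + 2 + (min (numSensitive m n k ω t) (k + 2 * m) : ℕ) := by
    rw [numVertices_eq, numVertices_eq, sub_le_iff_le_add']
    exact_mod_cast h'
  set L := min (numSensitive m n k ω t) (k + 2 * m)
  have hL1 : (L : ℝ) ≤ numSensitive m n k ω t := by exact_mod_cast hb1
  have hL2 : (L : ℝ) ≤ k + 2 * m := by exact_mod_cast hb2
  have hZ1' : (1 : ℝ) ≤ (descendants ω (n * m) t).card := by exact_mod_cast hZ1
  set Z : ℝ := ((descendants ω (n * m) t).card : ℝ)
  have hL0 : (0 : ℝ) ≤ L := Nat.cast_nonneg _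
  have h1 : (max (numVertices m n k ω - numVertices m n k (Function.update ω t c)) 0) ^ 2 ≤
      (Z + 2 + L) ^ 2 :=
    pow_le_pow_left₀ (le_max_right _ _) (max_le hr (by linarith)) 2
  have h2 : (L : ℝ) * L ≤ (k + 2 * m) * numSensitive m n k ω t :=
    mul_le_mul hL2 hL1 hL0 (by positivity)
  -- Since `Z ≥ 1`, `(Z + 2 + L)² ≤ 2 (3Z)² + 2 L²`; one factor `L` is bounded by `k + 2m`, the
  -- other by the number of sensitive vertices.
  nlinarith [sq_nonneg (Z + 2 - L)]

theorem natCast_le_add_two_pow_div (x h : ℕ) : (x : ℝ) ≤ h + 2 ^ x / 2 ^ h := by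
  rcases le_total x h with hx | hx
  · have : (x : ℝ) ≤ h := by exact_mod_cast hx
    have : (0 : ℝ) ≤ 2 ^ x / 2 ^ h := by positivity
    linarith
  · obtain ⟨d, rfl⟩ := Nat.exists_eq_add_of_le hx
    rw [pow_add, mul_div_cancel_left₀ _ (by positivity)]
    have : (d : ℝ) ≤ 2 ^ d := by exact_mod_cast (Nat.lt_two_pow_self (n := d)).le
    push_cast
    linarith

-- Exchanging sums, each certificate edge is counted once for each of its ancestors. The parameter
-- `h` truncates the chain length; longer chains are paid for by the exponential term.
open Classical in
theorem sum_numSensitive_le (m n k h : ℕ) (ω : ℕ → ℕ) :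
    ∑ t ∈ Finset.range (n * m), (numSensitive m n k ω t : ℝ) ≤
      k * h * numVertices m n k ω +
        n / 2 ^ h * ∑ e ∈ Finset.range (n * m), (2 : ℝ) ^ (ancestors ω e).card := by
  set G := merged m n ω
  set K := Finset.univ.filter fun w => k ≤ G.secondDegree w with hK
  have h1 (t : ℕ) : numSensitive m n k ω t ≤
      ∑ w ∈ K, ∑ e ∈ G.certificate k w, if t ∈ ancestors ω e then 1 else 0 := by
    refine (G.numSensitive_le_sum k _).trans (le_of_eq ?_)
    exact Finset.sum_congr rfl fun w _ => Finset.sum_congr rfl fun e _ => by simp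
  have h2 : ∑ t ∈ Finset.range (n * m), numSensitive m n k ω t ≤
      ∑ w ∈ K, ∑ e ∈ G.certificate k w, (ancestors ω e).card := by
    refine (Finset.sum_le_sum fun t _ => h1 t).trans ?_
    rw [Finset.sum_comm]
    refine Finset.sum_le_sum fun w _ => ?_
    rw [Finset.sum_comm]
    refine Finset.sum_le_sum fun e _ => ?_
    rw [← Finset.card_filter]
    exact Finset.card_le_card fun t ht => (Finset.mem_filter.mp ht).2
  have h3 : ∑ t ∈ Finset.range (n * m), (numSensitive m n k ω t : ℝ) ≤
      ∑ w ∈ K, ∑ e ∈ G.certificate k w, ((ancestors ω e).card : ℝ) := by exact_mod_cast h2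
  have hS : ∑ e : Fin (n * m), (2 : ℝ) ^ (ancestors ω e).card =
      ∑ e ∈ Finset.range (n * m), (2 : ℝ) ^ (ancestors ω e).card := by
    rw [Finset.sum_range]
  refine h3.trans ?_
  have h4 : ∀ w ∈ K, ∑ e ∈ G.certificate k w, ((ancestors ω e).card : ℝ) ≤
      k * h + (∑ e ∈ Finset.range (n * m), (2 : ℝ) ^ (ancestors ω e).card) / 2 ^ h := by
    intro w hw
    refine (Finset.sum_le_sum fun e _ => natCast_le_add_two_pow_div _ h).trans ?_
    rw [Finset.sum_add_distrib, Finset.sum_const, G.card_certificate (Finset.mem_filter.mp hw).2,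
      nsmul_eq_mul, ← Finset.sum_div, ← hS]
    gcongr
    exact Finset.subset_univ _
  refine (Finset.sum_le_sum h4).trans ?_
  rw [Finset.sum_const, nsmul_eq_mul, mul_add]
  have h5 : (K.card : ℝ) ≤ n := by exact_mod_cast (Finset.card_le_univ K).trans (by simp)
  have h6 : (K.card : ℝ) = numVertices m n k ω := rfl
  rw [h6] at h5 ⊢
  refine add_le_add (le_of_eq (by ring)) ?_
  rw [← mul_div_assoc, div_mul_eq_mul_div]
  gcongr

theorem sum_expect_two_pow_le {a : ℝ} (ha : 0 < a) (N : ℕ) :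
    ∑ e ∈ Finset.range N, expect a N (fun ω => (2 : ℝ) ^ (ancestors ω e).card) ≤
      2 * (N : ℝ) ^ 3 := by
  have h : ∀ e ∈ Finset.range N, expect a N (fun ω => (2 : ℝ) ^ (ancestors ω e).card) ≤
      2 * (N : ℝ) ^ 2 := by
    intro e he
    have heN := Finset.mem_range.mp he
    refine (expect_two_pow_card_ancestors_le ha heN).trans ?_
    have : (e : ℝ) + 1 ≤ N := by exact_mod_cast heN
    gcongr
  refine (Finset.sum_le_sum h).trans (le_of_eq ?_)
  rw [Finset.sum_const, Finset.card_range, nsmul_eq_mul]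
  ring

theorem variance_numVertices_le {a : ℝ} (ha : 0 < a) {q : ℝ} (hq : 1 ≤ q)
    (hqa : 2 / (1 + a) ≤ q) (m n k h : ℕ) :
    expect a (n * m) (fun ω => numVertices m n k ω ^ 2) -
        expect a (n * m) (numVertices m n k) ^ 2 ≤
      36 * ((n * m : ℕ) : ℝ) ^ q * (1 + Real.log (n * m : ℕ)) +
        2 * (k + 2 * m) * (k * h * expect a (n * m) (numVertices m n k) +
          n / 2 ^ h * (2 * ((n * m : ℕ) : ℝ) ^ 3)) := by
  set N := n * m with hN
  refine (variance_le_sum_expect ha N _).trans ?_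
  have h1 : ∀ t ∈ Finset.range N,
      expect a N (fun ω => ∑ c ∈ Finset.range (2 * t + 1), weight a t c *
        (max (numVertices m n k ω - numVertices m n k (Function.update ω t c)) 0) ^ 2) ≤
      18 * expect a N (fun ω => ((descendants ω N t).card : ℝ) ^ 2) +
        2 * (k + 2 * m) * expect a N (fun ω => (numSensitive m n k ω t : ℝ)) := by
    intro t ht
    rw [← expect_const_mul, ← expect_const_mul, ← expect_add]
    refine expect_mono ha N fun ω => ?_
    refine (Finset.sum_le_sum fun c _ => mul_le_mul_of_nonneg_left
      (sq_posPart_numVertices_sub_le k ω c (Finset.mem_range.mp ht))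
      (weight_nonneg ha t c)).trans (le_of_eq ?_)
    rw [← Finset.sum_mul, sum_weight ha, one_mul]
  refine (Finset.sum_le_sum h1).trans ?_
  rw [Finset.sum_add_distrib, ← Finset.mul_sum, ← Finset.mul_sum, ← expect_sum (s := Finset.range N)
    (g := fun t ω => (numSensitive m n k ω t : ℝ))]
  have h2 := sum_expect_sq_card_descendants_le ha hq hqa N
  have h3 := expect_mono ha N (sum_numSensitive_le m n k h)
  rw [expect_add, expect_const_mul, expect_const_mul] at h3
  have h4 := h3.trans (add_le_add_right (mul_le_mul_of_nonneg_left
    ((expect_sum N _ _).trans_le (sum_expect_two_pow_le ha N))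
    (show (0 : ℝ) ≤ n / 2 ^ h by positivity)) _)
  have h5 := mul_le_mul_of_nonneg_left h4 (show (0 : ℝ) ≤ 2 * (k + 2 * m) by positivity)
  linarith

theorem indegree_le_card_add (m n : ℕ) (hm : 0 < m) (ω : ℕ → ℕ) (u : Fin n)
    [DecidablePred fun e => (merged m n ω).src e ≠ u ∧ (merged m n ω).tgt e = u] :
    indegree ω (n * m) (u * m) ≤ (Finset.univ.filter fun e =>
      (merged m n ω).src e ≠ u ∧ (merged m n ω).tgt e = u).card + m := by
  refine le_trans ?_ (Nat.add_le_add_left (card_src_fiber_le m n ω u) _)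
  refine le_trans ?_ (Finset.card_union_le _ _)
  have hsub : (Finset.univ.filter fun e : Fin (n * m) => target ω e = u * m) ⊆
      (Finset.univ.filter fun e => (merged m n ω).src e ≠ u ∧ (merged m n ω).tgt e = u) ∪
        Finset.univ.filter fun e => (merged m n ω).src e = u := by
    intro e he
    simp only [Finset.mem_union, Finset.mem_filter, Finset.mem_univ, true_and] at he ⊢
    have : (merged m n ω).tgt e = u := by
      refine Fin.ext ?_
      change target ω e / m = u
      rw [he, Nat.mul_div_cancel _ hm]
    tauto
  refine le_trans (le_of_eq ?_) (Finset.card_le_card hsub)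
  rw [indegree, Finset.card_filter, Finset.card_filter, Finset.sum_range]

/-- Only edges into the first of the `m` vertices merged into `u` are counted, for the `U` oldest
`u`. In `3m`, the part `2m` comes from `sum_card_sub_le_numKVertices` and the last `m` from edges
sent by `u` itself. -/
theorem le_expect_numVertices {a : ℝ} (ha : 0 < a) {m n U : ℕ} (hm : 0 < m) (hU : U ≤ n) (k : ℕ) :
    U * (a * ((n : ℝ) / U) ^ (1 / (1 + a)) - (a + k + 3 * m)) ≤
      m * expect a (n * m) (numVertices m n k) := by
  set S : Finset (Fin n) := Finset.univ.filter fun u => (u : ℕ) < U with hS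
  have hcard : S.card = U := by
    rw [hS, Fin.card_filter_val_lt, min_eq_right hU]
  have h1 : ∀ ω, ∑ u ∈ S, (((indegree ω (n * m) (u * m) : ℝ) + a) - (a + k + 3 * m)) ≤
      m * numVertices m n k ω := by
    intro ω
    refine le_trans (Finset.sum_le_sum fun u _ => ?_)
      ((merged m n ω).sum_card_sub_le_numKVertices (fun x => by convert card_src_fiber_le m n ω x) k S)
    have h' : (indegree ω (n * m) (u * m) : ℝ) + a - (a + k + 3 * m) ≤
        ((Finset.univ.filter fun e =>
          (merged m n ω).src e ≠ u ∧ (merged m n ω).tgt e = u).card : ℝ) - (k + 2 * m) := by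
      have : (indegree ω (n * m) (u * m) : ℝ) ≤ _ :=
        Nat.cast_le.mpr (indegree_le_card_add m n hm ω u)
      push_cast at this
      linarith
    refine h'.trans_eq ?_
    congr!
  have h2 := expect_mono ha (n * m) h1
  rw [expect_const_mul, expect_sum] at h2
  refine le_trans ?_ h2
  rw [← hcard, ← nsmul_eq_mul, ← Finset.sum_const, hcard]
  refine Finset.sum_le_sum fun u hu => ?_
  have hu' : (u : ℕ) < U := (Finset.mem_filter.mp hu).2
  rw [expect_sub, expect_const ha]
  refine sub_le_sub_right (le_trans ?_ (le_expect_indegree ha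
    (Nat.mul_le_mul_right m u.2.le))) _
  have hm' : (0 : ℝ) < m := by exact_mod_cast hm
  have hUpos : (0 : ℝ) < U := by exact_mod_cast (Nat.zero_le _).trans_lt hu'
  refine mul_le_mul_of_nonneg_left (Real.rpow_le_rpow (by positivity) ?_ (by positivity)) ha.le
  have h3 : (((u : ℕ) * m : ℕ) : ℝ) + 1 ≤ U * m := by
    have : (u : ℕ) * m + 1 ≤ U * m := by
      calc (u : ℕ) * m + 1 ≤ (u : ℕ) * m + m := by omega
        _ = ((u : ℕ) + 1) * m := by ring
        _ ≤ U * m := Nat.mul_le_mul_right m hu'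
    exact_mod_cast this
  calc (n : ℝ) / U = (n * m) / (U * m) := by field_simp
    _ ≤ (((n * m : ℕ) : ℝ) + 1) / ((((u : ℕ) * m : ℕ) : ℝ) + 1) :=
      div_le_div₀ (by positivity) (by push_cast; linarith) (by positivity) h3

theorem exists_le_expect_numVertices {a : ℝ} (ha : 0 < a) {m : ℕ} (hm : 0 < m) :
    ∃ c > 0, ∃ R > 0, ∀ n k : ℕ, 1 ≤ k → R * (k : ℝ) ^ (1 + a) ≤ n →
      c * (n / (k : ℝ) ^ a) ≤ expect a (n * m) (numVertices m n k) := by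
  have hm' : (0 : ℝ) < m := by exact_mod_cast hm
  -- `B` makes `a + k + 3m ≤ B k` for `k ≥ 1`, and `R` makes the main term at least `2 B k` when `U
  -- ≤ n / (R k^(1 + a))`. Each of the `U` vertices then contributes at least `B k`.
  set B : ℝ := a + 1 + 3 * m with hB
  have hBpos : 0 < B := by positivity
  set R : ℝ := (2 * B / a) ^ (1 + a) with hR
  have hR1 : 1 ≤ R := by
    refine Real.one_le_rpow ?_ (by positivity)
    rw [le_div_iff₀ ha]
    nlinarith
  have hR0 : 0 < R := by positivity
  refine ⟨B / (2 * R * m), by positivity, R, hR0, fun n k hk hn => ?_⟩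
  have hk1 : (1 : ℝ) ≤ k := by exact_mod_cast hk
  have hk0 : (0 : ℝ) < k := by linarith
  set x : ℝ := n / (R * (k : ℝ) ^ (1 + a)) with hx
  have hden : 0 < R * (k : ℝ) ^ (1 + a) := by positivity
  have hx1 : 1 ≤ x := by rwa [hx, le_div_iff₀ hden, one_mul]
  set U := ⌊x⌋₊ with hU
  have hU1 : (1 : ℝ) ≤ U := by exact_mod_cast Nat.le_floor (by simpa using hx1)
  have hUx : (U : ℝ) ≤ x := Nat.floor_le (by linarith)
  have hxU : x < U + 1 := Nat.lt_floor_add_one x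
  have hUn : U ≤ n := by
    have : (U : ℝ) ≤ n := by
      refine hUx.trans (div_le_self (Nat.cast_nonneg _) ?_)
      exact one_le_mul_of_one_le_of_one_le hR1 (Real.one_le_rpow hk1 (by positivity))
    exact_mod_cast this
  have h1 : 2 * B / a * k ≤ ((n : ℝ) / U) ^ (1 / (1 + a)) := by
    have h2 : R * (k : ℝ) ^ (1 + a) ≤ n / U := by
      rw [le_div_iff₀ (by linarith), mul_comm, ← le_div_iff₀ hden]
      exact hUx
    have h3 : (R * (k : ℝ) ^ (1 + a)) ^ (1 / (1 + a)) = 2 * B / a * k := by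
      rw [hR, ← Real.mul_rpow (by positivity) (by positivity), ← Real.rpow_mul (by positivity),
        mul_one_div_cancel (by positivity), Real.rpow_one]
    rw [← h3]
    exact Real.rpow_le_rpow hden.le h2 (by positivity)
  have h4 := le_expect_numVertices ha hm hUn k
  have h5 : B * k ≤ a * ((n : ℝ) / U) ^ (1 / (1 + a)) - (a + k + 3 * m) := by
    have h6 := mul_le_mul_of_nonneg_left h1 ha.le
    have h7 : a * (2 * B / a * k) = 2 * (B * k) := by field_simp
    have h8 : a + k + 3 * m ≤ B * k := by nlinarith
    linarith
  have h9 : x / 2 * (B * k) ≤ m * expect a (n * m) (numVertices m n k) :=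
    (mul_le_mul (by linarith) h5 (by positivity) (by linarith)).trans h4
  have h10 : B / (2 * R * m) * (n / (k : ℝ) ^ a) = x / 2 * (B * k) / m := by
    rw [hx, Real.rpow_add hk0, Real.rpow_one]
    field_simp
  rw [h10, div_le_iff₀ hm', mul_comm (expect _ _ _)]
  exact h9

end Merged

/-! ### Comparison of exponents. -/

section Asymptotic

theorem eventually_two_mul_pow_le {η : ℝ} (hη : 0 < η) (C : ℝ) :
    ∀ᶠ n : ℕ in atTop, C * (n : ℝ) ^ 4 ≤ 2 ^ ⌈(n : ℝ) ^ η⌉₊ := by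
  have h1 : Tendsto (fun n : ℕ => (n : ℝ) ^ η) atTop atTop :=
    (tendsto_rpow_atTop hη).comp tendsto_natCast_atTop_atTop
  have h2 := (isLittleO_rpow_exp_pos_mul_atTop (4 / η) (Real.log_pos one_lt_two)).comp_tendsto h1
  have hC : 0 < 1 / (|C| + 1) := by positivity
  filter_upwards [h2.def hC] with n hn
  have h3 : ((n : ℝ) ^ η) ^ (4 / η) = (n : ℝ) ^ 4 := by
    rw [← Real.rpow_mul (Nat.cast_nonneg _), mul_div_cancel₀ _ hη.ne']
    exact_mod_cast Real.rpow_natCast (n : ℝ) 4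
  have h5 : (0 : ℝ) ≤ (n : ℝ) ^ 4 := by positivity
  simp only [Function.comp, h3, Real.norm_eq_abs, abs_of_nonneg h5, Real.abs_exp] at hn
  rw [div_mul_eq_mul_div, one_mul, le_div_iff₀ (by positivity)] at hn
  have h4 : Real.exp (Real.log 2 * (n : ℝ) ^ η) ≤ 2 ^ ⌈(n : ℝ) ^ η⌉₊ := by
    rw [← Real.rpow_def_of_pos two_pos, ← Real.rpow_natCast]
    exact Real.rpow_le_rpow_of_exponent_le one_le_two (Nat.le_ceil _)
  nlinarith [le_abs_self C]

theorem eventually_le_const_mul_rpow {k : ℕ → ℕ} {β : ℝ}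
    (hkO : (fun n => (k n : ℝ)) =O[atTop] fun n : ℕ => (n : ℝ) ^ β) :
    ∃ C, 1 ≤ C ∧ ∀ᶠ n in atTop, (k n : ℝ) ≤ C * (n : ℝ) ^ β := by
  obtain ⟨C, hC⟩ := hkO.bound
  refine ⟨max C 1, le_max_right _ _, ?_⟩
  filter_upwards [hC] with n hn
  have h0 : (0 : ℝ) ≤ (n : ℝ) ^ β := by positivity
  rw [Real.norm_of_nonneg (Nat.cast_nonneg _), Real.norm_of_nonneg h0] at hn
  exact hn.trans (mul_le_mul_of_nonneg_right (le_max_left _ _) h0)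

theorem eventually_const_le_rpow {η : ℝ} (hη : 0 < η) (C : ℝ) :
    ∀ᶠ n : ℕ in atTop, C ≤ (n : ℝ) ^ η :=
  ((tendsto_rpow_atTop hη).comp tendsto_natCast_atTop_atTop).eventually_ge_atTop C

theorem eventually_rpow_le_expect {a : ℝ} (ha : 0 < a) {m : ℕ} (hm : 0 < m) {k : ℕ → ℕ}
    (hk : ∀ n, 1 ≤ k n) {β C : ℝ} (hβa : (1 + a) * β < 1) (hC : 1 ≤ C)
    (hkC : ∀ᶠ n in atTop, (k n : ℝ) ≤ C * (n : ℝ) ^ β) :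
    ∃ c > 0, ∀ᶠ n : ℕ in atTop,
      c * (n : ℝ) ^ (1 - a * β) ≤ expect a (n * m) (numVertices m n (k n)) := by
  obtain ⟨c, hc, R, hR, h⟩ := exists_le_expect_numVertices ha hm
  refine ⟨c / C ^ a, by positivity, ?_⟩
  filter_upwards [hkC, eventually_const_le_rpow (sub_pos.mpr hβa) (R * C ^ (1 + a)),
    eventually_gt_atTop 0] with n hn hbig hn0
  have hn0' : (0 : ℝ) < n := by exact_mod_cast hn0
  have hk1 : (1 : ℝ) ≤ k n := by exact_mod_cast hk n
  have hpow {s : ℝ} (hs : 0 ≤ s) : (k n : ℝ) ^ s ≤ C ^ s * (n : ℝ) ^ (s * β) := by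
    refine (Real.rpow_le_rpow (by positivity) hn hs).trans (le_of_eq ?_)
    rw [Real.mul_rpow (by positivity) (by positivity), ← Real.rpow_mul hn0'.le, mul_comm β]
  refine le_trans ?_ (h n (k n) (hk n) ?_)
  · rw [Real.rpow_sub hn0', Real.rpow_one, div_mul_div_comm, mul_div_assoc']
    refine div_le_div_of_nonneg_left (by positivity) (by positivity) (hpow ha.le)
  · calc R * (k n : ℝ) ^ (1 + a) ≤ R * (C ^ (1 + a) * (n : ℝ) ^ ((1 + a) * β)) :=
          mul_le_mul_of_nonneg_left (hpow (by positivity)) hR.le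
      _ = (R * C ^ (1 + a)) * (n : ℝ) ^ ((1 + a) * β) := by ring
      _ ≤ (n : ℝ) ^ (1 - (1 + a) * β) * (n : ℝ) ^ ((1 + a) * β) :=
          mul_le_mul_of_nonneg_right hbig (by positivity)
      _ = n := by rw [← Real.rpow_add hn0', sub_add_cancel, Real.rpow_one]

theorem eventually_variance_le {a : ℝ} (ha : 0 < a) {m : ℕ} (hm : 0 < m) {k : ℕ → ℕ}
    (hk : ∀ n, 1 ≤ k n) {β C q η : ℝ} (hq : 1 ≤ q) (hqa : 2 / (1 + a) ≤ q) (hη : 0 < η)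
    (hkC : ∀ᶠ n in atTop, (k n : ℝ) ≤ C * (n : ℝ) ^ β)
    (hA : ∀ᶠ n in atTop, 1 ≤ expect a (n * m) (numVertices m n (k n))) :
    ∃ K > 0, ∀ᶠ n : ℕ in atTop,
      expect a (n * m) (fun ω => numVertices m n (k n) ω ^ 2) -
          expect a (n * m) (numVertices m n (k n)) ^ 2 ≤
        K * ((n : ℝ) ^ (q + η) +
          (n : ℝ) ^ (2 * β + η) * expect a (n * m) (numVertices m n (k n))) := by
  have hm' : (1 : ℝ) ≤ m := by exact_mod_cast hm
  set K₁ : ℝ := 36 * (1 + 1 / η) * (m : ℝ) ^ (q + η) with hK₁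
  set K₂ : ℝ := 6 * (1 + 2 * m) * C ^ 2 with hK₂
  refine ⟨K₁ + K₂, by positivity, ?_⟩
  filter_upwards [hkC, hA, eventually_gt_atTop 0, eventually_two_mul_pow_le hη (2 * (m : ℝ) ^ 3)]
    with n hn hA1 hn0 hpow
  have hn1 : (1 : ℝ) ≤ n := by exact_mod_cast hn0
  have hk1 : (1 : ℝ) ≤ k n := by exact_mod_cast hk n
  -- This truncation costs only a factor `O(n^η)`, while `2 ^ h` outgrows the polynomial bound for
  -- the long chains.
  set h := ⌈(n : ℝ) ^ η⌉₊ with hh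
  have hnη : 1 ≤ (n : ℝ) ^ η := Real.one_le_rpow hn1 hη.le
  have hh1 : 1 ≤ (h : ℝ) := hnη.trans (Nat.le_ceil _)
  have hh2 : (h : ℝ) ≤ 2 * (n : ℝ) ^ η := by
    have := Nat.ceil_lt_add_one (show 0 ≤ (n : ℝ) ^ η by positivity)
    linarith
  set A := expect a (n * m) (numVertices m n (k n)) with hAdef
  have hV := variance_numVertices_le ha hq hqa m n (k n) h
  rw [← hAdef] at hV
  have hN1 : (1 : ℝ) ≤ (n * m : ℕ) := by exact_mod_cast Nat.mul_pos hn0 hm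
  have h1 : 36 * ((n * m : ℕ) : ℝ) ^ q * (1 + Real.log (n * m : ℕ)) ≤ K₁ * (n : ℝ) ^ (q + η) := by
    have hlog := Real.log_le_rpow_div (show (0 : ℝ) ≤ (n * m : ℕ) by positivity) hη
    have hNη : 1 ≤ ((n * m : ℕ) : ℝ) ^ η := Real.one_le_rpow hN1 hη.le
    calc 36 * ((n * m : ℕ) : ℝ) ^ q * (1 + Real.log (n * m : ℕ))
        ≤ 36 * ((n * m : ℕ) : ℝ) ^ q * ((1 + 1 / η) * ((n * m : ℕ) : ℝ) ^ η) := by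
          refine mul_le_mul_of_nonneg_left ?_ (by positivity)
          rw [add_mul, one_mul, div_mul_eq_mul_div, one_mul]
          exact add_le_add hNη hlog
      _ = 36 * (1 + 1 / η) * ((n * m : ℕ) : ℝ) ^ (q + η) := by
          rw [Real.rpow_add (by linarith)]
          ring
      _ = K₁ * (n : ℝ) ^ (q + η) := by
          push_cast
          rw [Real.mul_rpow (by positivity) (by positivity), hK₁]
          ring
  have h2 : (n : ℝ) / 2 ^ h * (2 * ((n * m : ℕ) : ℝ) ^ 3) ≤ 1 := by
    rw [div_mul_eq_mul_div, div_le_one (by positivity)]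
    refine le_trans (le_of_eq ?_) hpow
    push_cast
    ring
  have h3 : 2 * ((k n : ℝ) + 2 * m) * (k n * h * A +
      n / 2 ^ h * (2 * ((n * m : ℕ) : ℝ) ^ 3)) ≤ K₂ * ((n : ℝ) ^ (2 * β + η) * A) := by
    have e1 : (k n : ℝ) + 2 * m ≤ (1 + 2 * m) * k n := by nlinarith
    have e2 : k n * h * A + n / 2 ^ h * (2 * ((n * m : ℕ) : ℝ) ^ 3) ≤
        k n * (3 * (n : ℝ) ^ η) * A := by
      have e3 : (k n : ℝ) * h * A ≤ k n * (2 * (n : ℝ) ^ η) * A := by gcongr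
      have e4 : 1 ≤ (k n : ℝ) * (n : ℝ) ^ η * A :=
        one_le_mul_of_one_le_of_one_le (one_le_mul_of_one_le_of_one_le hk1 hnη) hA1
      linarith
    have e5 : (k n : ℝ) ^ 2 ≤ C ^ 2 * (n : ℝ) ^ (2 * β) := by
      refine (pow_le_pow_left₀ (by linarith) hn 2).trans (le_of_eq ?_)
      rw [mul_pow, ← Real.rpow_natCast ((n : ℝ) ^ β), ← Real.rpow_mul (by linarith), mul_comm β]
      norm_num
    calc _ ≤ 2 * ((1 + 2 * m) * k n) * (k n * (3 * (n : ℝ) ^ η) * A) := by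
          refine mul_le_mul (by linarith) e2 ?_ (by positivity)
          have : 0 ≤ A := by linarith
          positivity
      _ = 6 * (1 + 2 * m) * ((n : ℝ) ^ η * A) * (k n : ℝ) ^ 2 := by ring
      _ ≤ 6 * (1 + 2 * m) * ((n : ℝ) ^ η * A) * (C ^ 2 * (n : ℝ) ^ (2 * β)) := by
          have : 0 ≤ A := by linarith
          exact mul_le_mul_of_nonneg_left e5 (by positivity)
      _ = K₂ * ((n : ℝ) ^ (2 * β + η) * A) := by
          rw [Real.rpow_add (by linarith), hK₂]
          ring
  have h4 : 0 ≤ (n : ℝ) ^ (q + η) := by positivity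
  have h5 : 0 ≤ (n : ℝ) ^ (2 * β + η) * A := mul_nonneg (by positivity) (by linarith)
  have hK₁0 : 0 ≤ K₁ := by positivity
  have hK₂0 : 0 ≤ K₂ := by positivity
  nlinarith [mul_nonneg hK₁0 h5, mul_nonneg hK₂0 h4]

theorem tendsto_prob_of_exponents {a : ℝ} (ha : 0 < a) {m : ℕ} (hm : 0 < m) {k : ℕ → ℕ}
    (hk : ∀ n, 1 ≤ k n) {β q : ℝ} (hβ : 0 ≤ β) (hβa : (1 + a) * β < 1) (hβ2 : (2 + a) * β < 1)
    (hq : 1 ≤ q) (hqa : 2 / (1 + a) ≤ q) (hqβ : q < 2 * (1 - a * β))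
    (hkO : (fun n => (k n : ℝ)) =O[atTop] fun n : ℕ => (n : ℝ) ^ β) :
    ∃ ε : ℝ, 0 < ε ∧ Tendsto (fun n : ℕ => (prob ha m n).real
      {f | (EY ha m n (k n)) ^ (1 - ε) < |Y m n (k n) f - EY ha m n (k n)|}) atTop (𝓝 0) := by
  classical
  obtain ⟨C, hC, hkC⟩ := eventually_le_const_mul_rpow hkO
  obtain ⟨c, hc, hA⟩ := eventually_rpow_le_expect ha hm hk hβa hC hkC
  set α := 1 - a * β with hα
  have hα1 : α ≤ 1 := by nlinarith
  have hα0 : 0 < α := by nlinarith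
  obtain ⟨γ, hγ0, hγ1, hγ2⟩ : ∃ γ > 0, γ ≤ α - 2 * β ∧ γ ≤ 2 * α - q :=
    ⟨min (α - 2 * β) (2 * α - q), lt_min (by rw [hα]; linarith) (by linarith), min_le_left _ _,
      min_le_right _ _⟩
  have hγ3 : γ ≤ 1 := by linarith
  -- Each of the two exponents is at most `-γ` before `ε` and `η` enter. They cost `2εα ≤ γ / 4` and
  -- `η = γ / 4`, which leaves `-γ / 2`.
  set ε := γ / 8 with hε
  set η := γ / 4 with hη
  have hA1 : ∀ᶠ n in atTop, 1 ≤ expect a (n * m) (numVertices m n (k n)) := by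
    filter_upwards [hA, eventually_const_le_rpow hα0 (1 / c)] with n hn hn'
    refine le_trans ?_ hn
    rwa [div_le_iff₀ hc, mul_comm] at hn'
  obtain ⟨K, hK, hV⟩ := eventually_variance_le ha hm hk hq hqa (show 0 < η by positivity) hkC hA1
  refine ⟨ε, by positivity, ?_⟩
  have hlim : Tendsto (fun n : ℕ => K * (1 / c ^ (2 - 2 * ε) + 1 / c ^ (1 - 2 * ε)) *
      (n : ℝ) ^ (-(γ / 2))) atTop (𝓝 0) := by
    have := ((tendsto_rpow_neg_atTop (show 0 < γ / 2 by positivity)).comp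
      tendsto_natCast_atTop_atTop).const_mul (K * (1 / c ^ (2 - 2 * ε) + 1 / c ^ (1 - 2 * ε)))
    simpa using this
  refine squeeze_zero' (Eventually.of_forall fun n => measureReal_nonneg) ?_ hlim
  filter_upwards [hA, hA1, hV, eventually_gt_atTop 0] with n hAn hA1n hVn hn0
  have hn0' : (0 : ℝ) < n := by exact_mod_cast hn0
  have hn1 : (1 : ℝ) ≤ n := by exact_mod_cast hn0
  rw [prob_real, EY_eq_expect]
  set A := expect a (n * m) (numVertices m n (k n)) with hAdef
  have hA0 : 0 < A := by linarith
  have hcheb := chebyshev ha (n * m) (numVertices m n (k n))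
    (show 0 < A ^ (1 - ε) by positivity)
  rw [← hAdef] at hcheb
  have hpowA : (A ^ (1 - ε)) ^ 2 = A ^ (2 - 2 * ε) := by
    rw [← Real.rpow_natCast, ← Real.rpow_mul hA0.le]
    congr 1
    push_cast
    ring
  rw [hpowA] at hcheb
  refine hcheb.trans ?_
  have hlow {s r : ℝ} (hs : 0 ≤ s) (hr : r - α * s ≤ -(γ / 2)) :
      (n : ℝ) ^ r / A ^ s ≤ 1 / c ^ s * (n : ℝ) ^ (-(γ / 2)) := by
    have h1 : c ^ s * (n : ℝ) ^ (α * s) ≤ A ^ s := by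
      rw [Real.rpow_mul hn0'.le, ← Real.mul_rpow hc.le (by positivity)]
      exact Real.rpow_le_rpow (by positivity) hAn hs
    calc (n : ℝ) ^ r / A ^ s ≤ (n : ℝ) ^ r / (c ^ s * (n : ℝ) ^ (α * s)) :=
          div_le_div_of_nonneg_left (by positivity) (by positivity) h1
      _ = 1 / c ^ s * (n : ℝ) ^ (r - α * s) := by
          rw [Real.rpow_sub hn0']
          field_simp
      _ ≤ _ := mul_le_mul_of_nonneg_left (Real.rpow_le_rpow_of_exponent_le hn1 hr)
          (by positivity)
  have hεα : 2 * ε * α ≤ 2 * ε := by nlinarith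
  have t1 := hlow (s := 2 - 2 * ε) (r := q + η) (by linarith) (by nlinarith)
  have t2 := hlow (s := 1 - 2 * ε) (r := 2 * β + η) (by linarith) (by nlinarith)
  have hsplit : A ^ (2 - 2 * ε) = A * A ^ (1 - 2 * ε) := by
    rw [← Real.rpow_one_add' hA0.le (by linarith)]
    congr 1
    ring
  calc _ ≤ K * ((n : ℝ) ^ (q + η) + (n : ℝ) ^ (2 * β + η) * A) / A ^ (2 - 2 * ε) :=
        div_le_div_of_nonneg_right hVn (by positivity)
    _ = K * ((n : ℝ) ^ (q + η) / A ^ (2 - 2 * ε) + (n : ℝ) ^ (2 * β + η) / A ^ (1 - 2 * ε)) := by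
        rw [mul_div_assoc, add_div]
        congr 2
        rw [hsplit]
        field_simp
    _ ≤ K * (1 / c ^ (2 - 2 * ε) * (n : ℝ) ^ (-(γ / 2)) +
          1 / c ^ (1 - 2 * ε) * (n : ℝ) ^ (-(γ / 2))) :=
        mul_le_mul_of_nonneg_left (add_le_add t1 t2) hK.le
    _ = _ := by ring

end Asymptotic

end BuckleyOsthus

theorem theorem8 (a : ℝ) (ha : 0 < a) (hconj : BuckleyOsthus.ExpectationConjecture ha)
    (m : ℕ) (hm : 1 ≤ m) (δ : ℝ) (hδ : 0 < δ) (k : ℕ → ℕ) (hk : ∀ n, 1 ≤ k n)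
    (hkO : (fun n => (k n : ℝ)) =O[atTop]
      fun n : ℕ => (n : ℝ) ^ min (1 / (2 + a + δ)) (1 / (2 * a + δ))) :
    ∃ ε : ℝ, 0 < ε ∧
      Tendsto (fun n : ℕ => (BuckleyOsthus.prob ha m n).real
        {f | (BuckleyOsthus.EY ha m n (k n)) ^ (1 - ε)
          < |BuckleyOsthus.Y m n (k n) f - BuckleyOsthus.EY ha m n (k n)|})
        atTop (𝓝 0) := by
  set β := min (1 / (2 + a + δ)) (1 / (2 * a + δ)) with hβ
  have hβ0 : 0 < β := lt_min (by positivity) (by positivity)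
  have h1 : (2 + a + δ) * β ≤ 1 := by
    have := mul_le_mul_of_nonneg_left (min_le_left (1 / (2 + a + δ)) (1 / (2 * a + δ)))
      (show 0 ≤ 2 + a + δ by positivity)
    rwa [mul_one_div_cancel (by positivity)] at this
  have h2 : (2 * a + δ) * β ≤ 1 := by
    have := mul_le_mul_of_nonneg_left (min_le_right (1 / (2 + a + δ)) (1 / (2 * a + δ)))
      (show 0 ≤ 2 * a + δ by positivity)
    rwa [mul_one_div_cancel (by positivity)] at this
  have hδβ : 0 < δ * β := by positivity
  -- For `q = 1` the condition `q < 2 (1 - aβ)` reads `2aβ < 1`; for `q = 2 / (1 + a)` it reduces to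
  -- `(1 + a) β < 1`.
  refine BuckleyOsthus.tendsto_prob_of_exponents ha hm hk (q := max 1 (2 / (1 + a))) hβ0.le
    (by nlinarith) (by nlinarith) (le_max_left _ _) (le_max_right _ _) (max_lt (by nlinarith) ?_)
    hkO
  rw [div_lt_iff₀ (by positivity)]
  nlinarith
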